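/- **Setting.** Let $\omega:\mathbb R\to[1,\infty)$ be measurable, and let $\mathcal P$ be a convex class of absolutely continuous probability distributions on $\mathbb R$ with $\int\omega\,dP<\infty$ for all $P\in\mathcal P$, which contains with each $P$ every probability measure $Q$ such that $cP\le Q\le CP$ for some constants $0<c\le C<\infty$. (Examples: all absolutely continuous distributions, with $\omega=1$; those with finite first moment, with $\omega(y)=1+|y|$; those with strictly positive density.) Equip $\mathcal P$ with the distance $\int\omega(y)|p(y)-q(y)|\,dy$ of densities; for $\omega=1$ this is the $L^1$ (total variation) distance. Let $\alpha:\mathcal P\to\mathbb R$. A jointly measurable function $L:\mathbb R\times\mathbb R\to\mathbb R$ is called a loss function *consistent* for $\alpha$ if for every $P\in\mathcal P$ the expectation $\mathbb E_P[L(x,Y)]$ is finite for all $x\in\mathbb R$ and $\alpha(P)$ is its unique minimizer over $x\in\mathbb R$; $\alpha$ is *elicitable* if such an $L$ exists. $\alpha$ is *locally nonconstant* if it is not constant on any neighbourhood in $\mathcal P$ of any $P\in\mathcal P$ for which $\alpha(P)$ is an interior point of the image $I=\alpha(\mathcal P)$. A measurable $V:\mathbb R\times\mathbb R\to\mathbb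 R$ is an *identification function* of $\alpha$ if $V(x,\cdot)$ is $P$-integrable for all $x\in\mathbb R$ and $P\in\mathcal P$, and $$x=\alpha(P)\iff \mathbb E_P[V(x,Y)]=0,$$ where "$\Leftarrow$" is required only for $x$ outside the boundary $\partial I$. **Lemma (Identification).** Let $\alpha$ be elicitable with respect to $\mathcal P$, continuous and locally nonconstant. Then there is an identification function $V$ of $\alpha$, with $|V(x,y)|\le\omega(y)$ for all $x,y$, such that: 1. Let $X,Y$ be real-valued functions on a probability space, $Y$ a random variable, and $\mathcal F$ a sub-$\sigma$-algebra, such that almost surely the regular conditional distribution $\mathcal L(Y|\mathcal F)$ lies in $\mathcal P$ and $X=\alpha(\mathcal L(Y|\mathcal F))$. Then, for every $\mathcal F$-measurable random vector $W$ in $\mathbb R^q$ for which $V(X,Y)\,W$ is integrable, $$\mathbb E[V(X,Y)\cdot W]=0 .$$ Moreover, $V(X,Y)\,W$ is integrable whenever $\omega(Y)\,W$ is. 2. For every loss function $L$ consistent for $\alpha$ there is a measurable $w:\mathbb R\to\mathbb R$ (so that the scaling factor $w(X)$ is determined by the forecast) such that for every $P\in\mathcal P$, for $P$-almost every $y$ and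 Lebesgue-almost every $x\in I$: if the partial derivative $L_{(x)}(x,y)$ exists, then $$L_{(x)}(x,y)=w(x)\,V(x,y).$$ If, in addition, $L(\cdot,y)$ is locally Lipschitz on the interior of $I$ for every $y$, then for every $P\in\mathcal P$, for $P$-almost every $y$ and Lebesgue-almost every $x\in I$, the derivative $L_{(x)}(x,y)$ exists and satisfies this equation. -/

import Mathlib

open MeasureTheory ProbabilityTheory Set
open scoped NNReal ENNReal

noncomputable section

/-- `𝓒` is a rich convex class of absolutely continuous probability distributions on the real line
whose members have a finite moment `∫ ω dP`.  Rich means that every probability measure whose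
density with respect to a member is bounded and bounded away from zero is again a member.
Examples: all absolutely continuous distributions (`ω = 1`), those with finite first moment
(`ω y = 1 + |y|`), those with a strictly positive density, and combinations of these. -/
structure AdmissibleClass (ω : ℝ → ℝ) (𝓒 : Set (Measure ℝ)) : Prop where
  isProbabilityMeasure : ∀ P ∈ 𝓒, IsProbabilityMeasure P
  absolutelyContinuous : ∀ P ∈ 𝓒, P ≪ volume
  integrable_weight : ∀ P ∈ 𝓒, Integrable ω P
  convex : Convex ℝ≥0 𝓒
  reweight : ∀ P ∈ 𝓒, ∀ Q : Measure ℝ, IsProbabilityMeasure Q →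
    ∀ c C : ℝ≥0, 0 < c → c • P ≤ Q → Q ≤ C • P → Q ∈ 𝓒

/-- The weighted total variation distance `∫ ω |p - q| dy` of absolutely continuous distributions
with densities `p` and `q`.  For `ω = 1` it is the `L¹` distance of the densities. -/
def weightedDist (ω : ℝ → ℝ) (P Q : Measure ℝ) : ℝ≥0∞ :=
  ∫⁻ y, ENNReal.ofReal
    (ω y * |(P.rnDeriv volume y).toReal - (Q.rnDeriv volume y).toReal|)

/-- Continuity of the functional `α : 𝓒 → ℝ` (only the values of `α` on `𝓒` matter). -/
def ContinuousFunctional (ω : ℝ → ℝ) (𝓒 : Set (Measure ℝ)) (α : Measure ℝ → ℝ) : Prop :=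
  ∀ P ∈ 𝓒, ∀ ε : ℝ, 0 < ε → ∃ δ : ℝ≥0∞, 0 < δ ∧
    ∀ Q ∈ 𝓒, weightedDist ω P Q < δ → |α Q - α P| < ε

/-- `α` is not constant on any neighbourhood of any `P ∈ 𝓒` whose value is an interior point of
the image of `α`. -/
def LocallyNonconstant (ω : ℝ → ℝ) (𝓒 : Set (Measure ℝ)) (α : Measure ℝ → ℝ) : Prop :=
  ∀ P ∈ 𝓒, α P ∈ interior (α '' 𝓒) → ∀ δ : ℝ≥0∞, 0 < δ →
    ∃ Q ∈ 𝓒, weightedDist ω P Q < δ ∧ α Q ≠ α P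

/-- The loss function `L` (forecast `x`, outcome `y`) is consistent for `α` on `𝓒`: for every
`P ∈ 𝓒` the expected losses are finite and `α P` is the unique minimizer over `x ∈ ℝ`. -/
structure IsConsistentLoss (𝓒 : Set (Measure ℝ)) (α : Measure ℝ → ℝ) (L : ℝ → ℝ → ℝ) :
    Prop where
  measurable : Measurable (Function.uncurry L)
  integrable : ∀ P ∈ 𝓒, ∀ x : ℝ, Integrable (L x) P
  lt_of_ne : ∀ P ∈ 𝓒, ∀ x : ℝ, x ≠ α P → ∫ y, L (α P) y ∂P < ∫ y, L x y ∂P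

/-- `α` is elicitable with respect to `𝓒`. -/
def Elicitable (𝓒 : Set (Measure ℝ)) (α : Measure ℝ → ℝ) : Prop :=
  ∃ L : ℝ → ℝ → ℝ, IsConsistentLoss 𝓒 α L

/-- `V` is an identification function of `α` on `𝓒`:  `x = α P ↔ E_P [V (x, Y)] = 0`, where the
implication from right to left is not required at the (at most two) end points `x` of the
image of `α`. -/
structure IsIdentificationFunction (𝓒 : Set (Measure ℝ)) (α : Measure ℝ → ℝ)
    (V : ℝ → ℝ → ℝ) : Prop where
  measurable : Measurable (Function.uncurry V)
  integrable : ∀ P ∈ 𝓒, ∀ x : ℝ, Integrable (V x) P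
  integral_eq_zero : ∀ P ∈ 𝓒, ∫ y, V (α P) y ∂P = 0
  eq_of_integral_eq_zero : ∀ P ∈ 𝓒, ∀ x : ℝ, x ∉ frontier (α '' 𝓒) →
    ∫ y, V x y ∂P = 0 → x = α P

/-- The regular conditional distribution of `Y` given the σ-algebra `F`. -/
def condLaw {Ω : Type*} (F : MeasurableSpace Ω) [mΩ : MeasurableSpace Ω]
    (μ : Measure Ω) [IsFiniteMeasure μ] (Y : Ω → ℝ) : Ω → Measure ℝ :=
  fun a => (@condDistrib Ω Ω ℝ _ _ _ mΩ F Y (fun b => b) μ _) a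

end

/-!
The proof rests on order sensitivity: since `α` is continuous, a consistent loss `L` satisfies
`E_P L u < E_P L v` for `α P ≤ u < v` and `E_P L u > E_P L v` for `u < v ≤ α P`
(`IsConsistentLoss.integral_sub_neg`, `IsConsistentLoss.integral_sub_pos`).  So the linear
functionals `P ↦ E_P [L u - L v]`, with `u < v` close to an interior level `x` of the image, are
negative on `{α ≤ u}` and positive on `{α ≥ v}`.

*Bounds.*  A linear functional that is nonpositive on a ball around `P₀` has an integrand bounded
above by `C |E_{P₀} g| ω`, because the class is rich
(`AdmissibleClass.exists_ae_le_of_forall_weightedDist_lt`).  With one ball on each side of the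
level, `|L u - L v| ≤ C ω E_{P₁} [L u - L v]` with the same constant for all `u, v` near `x`
(`IsRegularlyElicited.exists_abs_sub_le`).

*Level sets are hyperplanes.*  If `α` were constant on a segment pointing from `{α = x}` to a
distribution with a different value, the bounds would make `α` constant near its midpoint, against
local nonconstancy (`IsRegularlyElicited.lt_mix`, `IsRegularlyElicited.mix_lt`).  It follows that
linear functionals which asymptotically have the sign of `α - x` tend to zero on `{α = x}`, and hence
are asymptotically proportional to each other (`IsRegularlyElicited.exists_tendsto_of_sign`,
`IsRegularlyElicited.tendsto_mul_of_sign`).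

*Construction of `V`.*  The normalized differences `L x - L (x + 1 / (n + 1))`, divided by `ω`, are
bounded, and their expectations converge under every member of the class.  The class is dominated by
countably many members, and the limits of the integrals form a kernel in `x`, whose Radon-Nikodym
derivative is a jointly measurable weak limit `V`
(`AdmissibleClass.exists_measurable_integral_limit`); `E_P V(x, Y)` has the sign of `α P - x`.

*Moment condition.*  The sign of `E_P V(q, Y)` for rational `q` determines `α P`, so `X` is almost
surely equal to an `F`-measurable function, and the claim is the disintegration of the law of `Y`
along `F`.

*Derivatives.*  For almost every `x` the expected losses of two reference distributions are
differentiable at `x`, so by proportionality the expected difference quotients of `L` at `x` converge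
to `w(x) E_P V(x, Y)` for every `P`.  Weak and pointwise limits agree where both exist
(`ae_eq_of_tendsto_setIntegral`), and Fubini exchanges the order of `x` and `y`.
-/

open Filter Topology

/-! ### Distances, segments and perturbations in the class -/

section

/-- If `Q` arises from `P` by adding the mass `m₁` and removing the mass `m₂`, their distance is at
most the weighted mass moved.  All distances below are estimated in this way, without densities. -/
theorem weightedDist_le_of_add_eq {ω : ℝ → ℝ} (hω : Measurable ω) (h0 : ∀ y, 0 ≤ ω y)
    {P Q m₁ m₂ : Measure ℝ} [IsFiniteMeasure P] [IsFiniteMeasure Q] [IsFiniteMeasure m₁]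
    [IsFiniteMeasure m₂] (h₁ : m₁ ≪ volume) (h₂ : m₂ ≪ volume) (h : P + m₁ = Q + m₂) :
    weightedDist ω P Q
      ≤ ∫⁻ y, ENNReal.ofReal (ω y) ∂m₁ + ∫⁻ y, ENNReal.ofReal (ω y) ∂m₂ := by
  have hω' : Measurable fun y => ENNReal.ofReal (ω y) := hω.ennreal_ofReal
  rw [← lintegral_rnDeriv_mul h₁ hω'.aemeasurable, ← lintegral_rnDeriv_mul h₂ hω'.aemeasurable,
    ← lintegral_add_left (by fun_prop), weightedDist]
  refine lintegral_mono_ae ?_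
  have e₁ := Measure.rnDeriv_add' P m₁ volume
  have e₂ := Measure.rnDeriv_add' Q m₂ volume
  rw [h] at e₁
  filter_upwards [e₁, e₂, P.rnDeriv_lt_top volume, Q.rnDeriv_lt_top volume,
    m₁.rnDeriv_lt_top volume, m₂.rnDeriv_lt_top volume] with y h₁ h₂ hP hQ hm₁ hm₂
  rw [h₁] at h₂
  simp only [Pi.add_apply] at h₂
  lift P.rnDeriv volume y to ℝ≥0 using hP.ne with p
  lift Q.rnDeriv volume y to ℝ≥0 using hQ.ne with q
  lift m₁.rnDeriv volume y to ℝ≥0 using hm₁.ne with a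
  lift m₂.rnDeriv volume y to ℝ≥0 using hm₂.ne with b
  have h₃ : (p : ℝ) + a = q + b := by exact_mod_cast h₂
  have e : (a : ℝ≥0∞) * ENNReal.ofReal (ω y) + b * ENNReal.ofReal (ω y)
      = ENNReal.ofReal (ω y * (a + b)) := by
    rw [ENNReal.ofReal_mul (h0 y), ENNReal.ofReal_add a.coe_nonneg b.coe_nonneg]
    simp; ring
  rw [e]
  refine ENNReal.ofReal_le_ofReal (mul_le_mul_of_nonneg_left ?_ (h0 y))
  simp only [ENNReal.coe_toReal]
  rw [abs_le]
  have := a.2; have := b.2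
  constructor <;> simp only [NNReal.val_eq_coe] at * <;> linarith

theorem ae_volume_of_ae {P : Measure ℝ} [IsFiniteMeasure P] (hP : P ≪ volume) {p : ℝ → Prop}
    (h : ∀ᵐ y ∂P, p y) : ∀ᵐ y, P.rnDeriv volume y ≠ 0 → p y := by
  rw [← Measure.withDensity_rnDeriv_eq _ _ hP] at h
  rwa [ae_withDensity_iff (Measure.measurable_rnDeriv _ _)] at h

/-- Expectations of functions bounded by a multiple of the weight are Lipschitz in the
distribution. -/
theorem abs_integral_sub_le_of_weightedDist_lt {ω : ℝ → ℝ}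
    {P Q : Measure ℝ} [IsFiniteMeasure P] [IsFiniteMeasure Q]
    (hP : P ≪ volume) (hQ : Q ≪ volume) {g : ℝ → ℝ} {K r : ℝ} (hK : 0 ≤ K) (hr : 0 ≤ r)
    (hgP : Integrable g P) (hgQ : Integrable g Q)
    (bP : ∀ᵐ y ∂P, |g y| ≤ K * ω y) (bQ : ∀ᵐ y ∂Q, |g y| ≤ K * ω y)
    (h : weightedDist ω P Q < ENNReal.ofReal r) :
    |∫ y, g y ∂P - ∫ y, g y ∂Q| ≤ K * r := by
  rw [← integral_rnDeriv_smul hP, ← integral_rnDeriv_smul hQ, ← integral_sub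
    ((integrable_rnDeriv_smul_iff hP).2 hgP) ((integrable_rnDeriv_smul_iff hQ).2 hgQ)]
  have := norm_integral_le_lintegral_norm
    (fun y => (P.rnDeriv volume y).toReal • g y - (Q.rnDeriv volume y).toReal • g y) (μ := volume)
  rw [Real.norm_eq_abs] at this
  refine this.trans (ENNReal.toReal_le_of_le_ofReal (by positivity) ?_)
  rw [ENNReal.ofReal_mul hK]
  refine le_trans ?_ (mul_le_mul_right h.le _)
  rw [weightedDist, ← lintegral_const_mul' _ _ ENNReal.ofReal_ne_top]
  refine lintegral_mono_ae ?_
  filter_upwards [ae_volume_of_ae hP bP, ae_volume_of_ae hQ bQ] with y h₁ h₂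
  rw [← ENNReal.ofReal_mul hK]
  refine ENNReal.ofReal_le_ofReal ?_
  simp only [smul_eq_mul]
  rw [← sub_mul, norm_mul, Real.norm_eq_abs, Real.norm_eq_abs, mul_comm, ← mul_assoc]
  by_cases hp : P.rnDeriv volume y = 0
  · by_cases hq : Q.rnDeriv volume y = 0
    · simp [hp, hq]
    · exact mul_le_mul_of_nonneg_right (h₂ hq) (abs_nonneg _)
  · exact mul_le_mul_of_nonneg_right (h₁ hp) (abs_nonneg _)

/-- The segment from `P` to `Q` in the space of measures, parametrized by `t ∈ [0, 1]`. -/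
noncomputable def mix (t : ℝ) (P Q : Measure ℝ) : Measure ℝ := (1 - t).toNNReal • P + t.toNNReal • Q

@[simp] theorem mix_zero (P Q : Measure ℝ) : mix 0 P Q = P := by simp [mix]
@[simp] theorem mix_one (P Q : Measure ℝ) : mix 1 P Q = Q := by simp [mix]

theorem mix_comm (P Q : Measure ℝ) (t : ℝ) : mix t P Q = mix (1 - t) Q P := by
  simp [mix, add_comm]

instance (t : ℝ) (P Q : Measure ℝ) [IsFiniteMeasure P] [IsFiniteMeasure Q] :
    IsFiniteMeasure (mix t P Q) := by unfold mix; infer_instance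

theorem integral_mix {P Q : Measure ℝ} {g : ℝ → ℝ} (hP : Integrable g P) (hQ : Integrable g Q)
    {t : ℝ} (h0 : 0 ≤ t) (h1 : t ≤ 1) :
    ∫ y, g y ∂(mix t P Q) = (1 - t) * ∫ y, g y ∂P + t * ∫ y, g y ∂Q := by
  rw [mix, integral_add_measure (hP.smul_measure_nnreal) (hQ.smul_measure_nnreal),
    integral_smul_nnreal_measure, integral_smul_nnreal_measure]
  simp [NNReal.smul_def, h0, h1]

namespace AdmissibleClass

variable {ω : ℝ → ℝ} {𝓒 : Set (Measure ℝ)}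

theorem mix_mem (h : AdmissibleClass ω 𝓒) {P Q : Measure ℝ} (hP : P ∈ 𝓒) (hQ : Q ∈ 𝓒) {t : ℝ}
    (h0 : 0 ≤ t) (h1 : t ≤ 1) : mix t P Q ∈ 𝓒 := by
  refine h.convex hP hQ zero_le zero_le ?_
  rw [← Real.toNNReal_add (by linarith) h0]
  simp

/-- The class is stable under adding a measure which is dominated by one of its members, and
normalizing. -/
theorem normalize_add_mem (h : AdmissibleClass ω 𝓒) {R m : Measure ℝ} (hR : R ∈ 𝓒) {c : ℝ≥0}
    (hm : m ≤ c • R) : (1 + (m univ).toNNReal)⁻¹ • (R + m) ∈ 𝓒 := by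
  have := h.isProbabilityMeasure R hR
  have hfin : m univ ≠ ∞ := by
    refine ne_top_of_le_ne_top ?_ (hm univ)
    rw [Measure.coe_nnreal_smul_apply, measure_univ, mul_one]
    exact ENNReal.coe_ne_top
  set k : ℝ≥0 := (1 + (m univ).toNNReal)⁻¹ with hk
  have hk0 : 0 < k := by positivity
  refine h.reweight R hR _ ⟨?_⟩ k (k * (1 + c)) hk0 ?_ ?_
  · have : (1 : ℝ≥0∞) + m univ = ((1 + (m univ).toNNReal : ℝ≥0) : ℝ≥0∞) := by
      push_cast; rw [ENNReal.coe_toNNReal hfin]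
    rw [Measure.coe_nnreal_smul_apply, Measure.add_apply, measure_univ, this]
    rw [← ENNReal.coe_mul, hk, inv_mul_cancel₀ (by positivity)]
    rfl
  · intro s
    simp only [Measure.coe_nnreal_smul_apply, Measure.add_apply]
    gcongr
    exact le_self_add
  · intro s
    have := hm s
    simp only [Measure.coe_nnreal_smul_apply, Measure.add_apply] at this ⊢
    push_cast
    rw [mul_assoc, add_mul, one_mul]
    gcongr

theorem one_le_integral (h : AdmissibleClass ω 𝓒) (hω : ∀ y, 1 ≤ ω y) {P : Measure ℝ}
    (hP : P ∈ 𝓒) : 1 ≤ ∫ y, ω y ∂P := by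
  have := h.isProbabilityMeasure P hP
  simpa using integral_mono (integrable_const (1 : ℝ)) (h.integrable_weight P hP) hω

theorem lintegral_weight (h : AdmissibleClass ω 𝓒) (hω : ∀ y, 1 ≤ ω y) {P : Measure ℝ}
    (hP : P ∈ 𝓒) : ∫⁻ y, ENNReal.ofReal (ω y) ∂P = ENNReal.ofReal (∫ y, ω y ∂P) :=
  (ofReal_integral_eq_lintegral_ofReal (h.integrable_weight P hP)
    (.of_forall fun y => zero_le_one.trans (hω y))).symm

theorem weightedDist_mix_le (h : AdmissibleClass ω 𝓒) (hωm : Measurable ω) (hω : ∀ y, 1 ≤ ω y)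
    {P Q : Measure ℝ} (hP : P ∈ 𝓒) (hQ : Q ∈ 𝓒) {s t : ℝ} (hs : 0 ≤ s) (hs1 : s ≤ 1)
    (ht : 0 ≤ t) (ht1 : t ≤ 1) :
    weightedDist ω (mix s P Q) (mix t P Q)
      ≤ ENNReal.ofReal (|t - s| * (∫ y, ω y ∂P + ∫ y, ω y ∂Q)) := by
  have := h.isProbabilityMeasure P hP
  have := h.isProbabilityMeasure Q hQ
  have hP1 := h.one_le_integral hω hP
  have hQ1 := h.one_le_integral hω hQ
  have h0 : ∀ y, 0 ≤ ω y := fun y => zero_le_one.trans (hω y)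
  have aux : ∀ (u : ℝ≥0) (M : Measure ℝ), M ≪ volume → u • M ≪ volume := fun u M hM =>
    hM.smul_left u
  rcases le_total s t with hst | hst
  · have key : mix s P Q + (t - s).toNNReal • Q = mix t P Q + (t - s).toNNReal • P := by
      have e1 : (1 - s).toNNReal = (1 - t).toNNReal + (t - s).toNNReal := by
        rw [← Real.toNNReal_add (by linarith) (by linarith)]; congr 1; ring
      have e2 : t.toNNReal = s.toNNReal + (t - s).toNNReal := by
        rw [← Real.toNNReal_add (by linarith) (by linarith)]; congr 1; ring
      simp only [mix, e1, e2, add_smul]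
      abel
    refine (weightedDist_le_of_add_eq hωm h0 (aux _ _ (h.absolutelyContinuous Q hQ))
      (aux _ _ (h.absolutelyContinuous P hP)) key).trans ?_
    rw [lintegral_smul_measure, lintegral_smul_measure, h.lintegral_weight hω hP,
      h.lintegral_weight hω hQ, abs_of_nonneg (by linarith), add_comm,
      ENNReal.ofReal_mul (by linarith), ENNReal.ofReal_add (by linarith) (by linarith), mul_add]
    rfl
  · have key : mix s P Q + (s - t).toNNReal • P = mix t P Q + (s - t).toNNReal • Q := by
      have e1 : (1 - t).toNNReal = (1 - s).toNNReal + (s - t).toNNReal := by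
        rw [← Real.toNNReal_add (by linarith) (by linarith)]; congr 1; ring
      have e2 : s.toNNReal = t.toNNReal + (s - t).toNNReal := by
        rw [← Real.toNNReal_add (by linarith) (by linarith)]; congr 1; ring
      simp only [mix, e1, e2, add_smul]
      abel
    refine (weightedDist_le_of_add_eq hωm h0 (aux _ _ (h.absolutelyContinuous P hP))
      (aux _ _ (h.absolutelyContinuous Q hQ)) key).trans ?_
    rw [lintegral_smul_measure, lintegral_smul_measure, h.lintegral_weight hω hP,
      h.lintegral_weight hω hQ, abs_sub_comm, abs_of_nonneg (by linarith),
      ENNReal.ofReal_mul (by linarith), ENNReal.ofReal_add (by linarith) (by linarith), mul_add]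
    rfl

/-- Expectations over events are affine combinations of expectations under members of the
class. -/
theorem exists_setIntegral_eq (h : AdmissibleClass ω 𝓒) {P : Measure ℝ}
    (hP : P ∈ 𝓒) (A : Set ℝ) : ∃ Q ∈ 𝓒, ∃ c : ℝ, ∀ f : ℝ → ℝ, Integrable f P →
      ∫ y in A, f y ∂P = c * ∫ y, f y ∂Q - ∫ y, f y ∂P := by
  have hm : P.restrict A ≤ (1 : ℝ≥0) • P := by simpa using Measure.restrict_le_self
  have hQ := h.normalize_add_mem hP hm
  set k : ℝ≥0 := (1 + ((P.restrict A) univ).toNNReal)⁻¹ with hk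
  have hk0 : (k : ℝ) ≠ 0 := by
    rw [hk]; positivity
  refine ⟨_, hQ, (k : ℝ)⁻¹, fun f hf => ?_⟩
  rw [integral_smul_nnreal_measure, integral_add_measure hf hf.integrableOn,
    NNReal.smul_def, smul_eq_mul, inv_mul_cancel_left₀ hk0]
  ring

end AdmissibleClass

end

/-! ### One-sided bounds and order sensitivity -/

section

/-- If `E_Q g ≤ 0` for all `Q` in a ball around `P₀`, then `g` is bounded above by the weight times
`C |E_{P₀} g|`, where `C` depends on the ball only: `P₀` can be perturbed by an arbitrary mass of
small `ω`-norm under any member of the class without making the expectation of `g` positive. -/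
theorem AdmissibleClass.exists_ae_le_of_forall_weightedDist_lt {ω : ℝ → ℝ} {𝓒 : Set (Measure ℝ)}
    (h : AdmissibleClass ω 𝓒) (hωm : Measurable ω) (hω : ∀ y, 1 ≤ ω y)
    {P₀ : Measure ℝ} (hP₀ : P₀ ∈ 𝓒) {δ : ℝ≥0∞} (hδ : 0 < δ) :
    ∃ C : ℝ, 0 < C ∧ ∀ g : ℝ → ℝ, (∀ P ∈ 𝓒, Integrable g P) →
      (∀ Q ∈ 𝓒, weightedDist ω P₀ Q < δ → ∫ y, g y ∂Q ≤ 0) →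
      ∀ P ∈ 𝓒, ∀ᵐ y ∂P, g y ≤ C * (-∫ y, g y ∂P₀) * ω y := by
  obtain ⟨r, hr, hrδ⟩ : ∃ r : ℝ, 0 < r ∧ ENNReal.ofReal r ≤ δ := by
    obtain ⟨r, h1, h2⟩ := ENNReal.lt_iff_exists_real_btwn.1 hδ
    exact ⟨r, by simpa using h2.1, h2.2.le⟩
  have := h.isProbabilityMeasure P₀ hP₀
  have h0 : ∀ y, 0 ≤ ω y := fun y => zero_le_one.trans (hω y)
  set M₀ := ∫ y, ω y ∂P₀ with hM₀
  have hM₀1 : 1 ≤ M₀ := h.one_le_integral hω hP₀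
  refine ⟨2 * (1 + M₀) / r, by positivity, fun g hg hball P hP => ?_⟩
  have := h.isProbabilityMeasure P hP
  set M := ∫ y, ω y ∂P with hM
  have hM1 : 1 ≤ M := h.one_le_integral hω hP
  have iω := h.integrable_weight P hP
  refine ae_le_of_forall_setIntegral_le (hg P hP) (iω.const_mul _) fun A hA _ => ?_
  rw [integral_const_mul]
  set N := ∫ y in A, ω y ∂P with hN
  set p := P.real A with hp
  have hpN : p ≤ N := by
    have := setIntegral_mono (s := A) (integrable_const (1 : ℝ)).integrableOn iω.integrableOn hω
    simpa [hp] using this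
  have hp0 : 0 ≤ p := measureReal_nonneg
  rcases (hp0.trans hpN).eq_or_lt with hN0 | hNpos
  · have hPA : P A = 0 := by
      have : p = 0 := le_antisymm (hpN.trans hN0.ge) hp0
      rwa [hp, measureReal_eq_zero_iff] at this
    rw [Measure.restrict_eq_zero.2 hPA, integral_zero_measure, ← hN0, mul_zero]
  -- The amount of mass on `A` that may be added, up to the error terms in `ε`.
  set s := r / (2 * (1 + M₀) * N) with hs
  have hs0 : 0 < s := by positivity
  -- Mass on `A` can be added to `P₀` itself only where `P₀` charges `A`; it can always be added to
  -- `(1 - ε) P₀ + ε P`, so `ε` tends to zero at the end.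
  have key : ∀ ε : ℝ, 0 < ε → ε < 1 → ε * (M + M₀) < r / 2 →
      (1 - ε) * ∫ y, g y ∂P₀ + ε * ∫ y, g y ∂P + s * ∫ y in A, g y ∂P ≤ 0 := by
    intro ε hε hε1 hεr
    set R := mix ε P₀ P with hR
    have hRC : R ∈ 𝓒 := h.mix_mem hP₀ hP hε.le hε1.le
    have := h.isProbabilityMeasure R hRC
    set m : Measure ℝ := s.toNNReal • P.restrict A with hm
    have hmR : m ≤ (s.toNNReal / ε.toNNReal) • R := by
      have hε' : ε.toNNReal ≠ 0 := by simpa using hε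
      have : m ≤ (s.toNNReal / ε.toNNReal) • (ε.toNNReal • P) := by
        rw [smul_smul, div_mul_cancel₀ _ hε']
        intro B
        simp only [hm, Measure.coe_nnreal_smul_apply]
        gcongr
        exact Measure.restrict_le_self
      refine this.trans fun B => ?_
      simp only [hR, mix, Measure.coe_nnreal_smul_apply, Measure.add_apply]
      gcongr
      exact le_add_self
    have hQ := h.normalize_add_mem hRC hmR
    have hmu : (m univ).toNNReal = (s * p).toNNReal := by
      rw [hm, Measure.coe_nnreal_smul_apply, Measure.restrict_apply_univ, hp, Measure.real,
        ENNReal.toNNReal_mul, Real.toNNReal_mul hs0.le, ENNReal.toNNReal_coe]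
      congr 1
      exact (ENNReal.toNNReal_toReal_eq (P A)).symm
    rw [hmu] at hQ
    set k : ℝ≥0 := (1 + (s * p).toNNReal)⁻¹ with hk
    have hkR : (k : ℝ) * (1 + s * p) = 1 := by
      rw [hk]
      push_cast
      rw [Real.coe_toNNReal _ (by positivity)]
      exact inv_mul_cancel₀ (by positivity)
    have hk0 : (0 : ℝ) < k := by
      rw [hk]; positivity
    have hk1 : (k : ℝ) ≤ 1 := by nlinarith [mul_nonneg hs0.le hp0]
    have hQdef : k • (R + m)
        = (k * (1 - ε).toNNReal) • P₀ + k • (ε.toNNReal • P + m) := by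
      simp only [hR, mix, smul_add, smul_smul]
      abel
    have hsplit : P₀ + k • (ε.toNNReal • P + m)
        = k • (R + m) + (k * (ε + s * p).toNNReal) • P₀ := by
      rw [hQdef]
      have : (1 : ℝ≥0) = k * (1 - ε).toNNReal + k * (ε + s * p).toNNReal := by
        rw [← mul_add, ← Real.toNNReal_add (by linarith) (by positivity)]
        ext
        push_cast
        rw [Real.coe_toNNReal _ (by positivity)]
        linarith
      conv_lhs => rw [← one_smul ℝ≥0 P₀, this, add_smul]
      abel
    have hdist : weightedDist ω P₀ (k • (R + m)) < δ := by
      have hPac := h.absolutelyContinuous P hP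
      have hP₀ac := h.absolutelyContinuous P₀ hP₀
      refine lt_of_le_of_lt (weightedDist_le_of_add_eq hωm h0 (Measure.AbsolutelyContinuous.smul_left
        (Measure.AbsolutelyContinuous.add_left (hPac.smul_left _)
          ((Measure.restrict_le_self.absolutelyContinuous.trans hPac).smul_left _)) _)
        (hP₀ac.smul_left _) hsplit) ?_
      have e1 : ∫⁻ y, ENNReal.ofReal (ω y) ∂(k • (ε.toNNReal • P + m))
          = ENNReal.ofReal (k * (ε * M + s * N)) := by
        rw [hm, lintegral_smul_measure, lintegral_add_measure, lintegral_smul_measure,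
          lintegral_smul_measure, h.lintegral_weight hω hP,
          ← ofReal_integral_eq_lintegral_ofReal iω.integrableOn (.of_forall h0),
          ENNReal.ofReal_mul hk0.le, ENNReal.ofReal_add (by positivity) (by positivity),
          ENNReal.ofReal_mul hε.le, ENNReal.ofReal_mul hs0.le, ENNReal.ofReal_coe_nnreal]
        rfl
      have e2 : ∫⁻ y, ENNReal.ofReal (ω y) ∂((k * (ε + s * p).toNNReal) • P₀)
          = ENNReal.ofReal (k * (ε + s * p) * M₀) := by
        rw [lintegral_smul_measure, h.lintegral_weight hω hP₀,
          ENNReal.ofReal_mul (by positivity), ENNReal.ofReal_mul hk0.le, ENNReal.ofReal_coe_nnreal,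
          ENNReal.smul_def, ENNReal.coe_mul]
        rfl
      rw [e1, e2, ← ENNReal.ofReal_add (by positivity) (by positivity)]
      refine lt_of_lt_of_le ((ENNReal.ofReal_lt_ofReal_iff hr).2 ?_) hrδ
      have hsN : s * ((1 + M₀) * N) = r / 2 := by rw [hs]; field_simp
      have h3 : s * p * M₀ ≤ s * N * M₀ := by gcongr
      have h4 : ε * M + s * N + (ε + s * p) * M₀ < r := by nlinarith
      have h5 : 0 ≤ ε * M + s * N + (ε + s * p) * M₀ := by positivity
      nlinarith
    have iR : Integrable g R := hg R hRC
    have im : Integrable g m := (hg P hP).integrableOn.smul_measure_nnreal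
    have := hball _ hQ hdist
    rw [integral_smul_nnreal_measure, integral_add_measure iR im, hR,
      integral_mix (hg P₀ hP₀) (hg P hP) hε.le hε1.le, hm, integral_smul_nnreal_measure,
      NNReal.smul_def, NNReal.smul_def, smul_eq_mul, smul_eq_mul, Real.coe_toNNReal _ hs0.le] at this
    exact nonpos_of_mul_nonpos_right this hk0
  have lim : Tendsto (fun ε : ℝ => (1 - ε) * ∫ y, g y ∂P₀ + ε * ∫ y, g y ∂P + s * ∫ y in A, g y ∂P)
      (𝓝[>] 0) (𝓝 ((1 - 0) * ∫ y, g y ∂P₀ + 0 * ∫ y, g y ∂P + s * ∫ y in A, g y ∂P)) := by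
    apply tendsto_nhdsWithin_of_tendsto_nhds
    exact Continuous.tendsto (by fun_prop) 0
  have hle := le_of_tendsto lim (b := 0) (by
    have h1 : ∀ᶠ ε : ℝ in 𝓝[>] 0, ε < 1 :=
      tendsto_nhdsWithin_of_tendsto_nhds (tendsto_id (α := ℝ)) |>.eventually_lt_const one_pos
    have h2 : ∀ᶠ ε : ℝ in 𝓝[>] 0, ε * (M + M₀) < r / 2 := by
      have : Tendsto (fun ε : ℝ => ε * (M + M₀)) (𝓝[>] 0) (𝓝 (0 * (M + M₀))) :=
        tendsto_nhdsWithin_of_tendsto_nhds (Continuous.tendsto (by fun_prop) 0)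
      exact this.eventually_lt_const (by rw [zero_mul]; positivity)
    filter_upwards [self_mem_nhdsWithin, h1, h2] with ε h0 h1 h2 using key ε h0 h1 h2)
  have e : 2 * (1 + M₀) / r * (-∫ y, g y ∂P₀) * N = (-∫ y, g y ∂P₀) / s := by
    rw [hs]; field_simp
  rw [e, le_div_iff₀ hs0]
  linarith

variable {ω : ℝ → ℝ} {𝓒 : Set (Measure ℝ)} {α : Measure ℝ → ℝ} {L : ℝ → ℝ → ℝ}

theorem ContinuousFunctional.continuousOn_mix (hα : ContinuousFunctional ω 𝓒 α)
    (h : AdmissibleClass ω 𝓒) (hωm : Measurable ω) (hω : ∀ y, 1 ≤ ω y)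
    {P Q : Measure ℝ} (hP : P ∈ 𝓒) (hQ : Q ∈ 𝓒) :
    ContinuousOn (fun t => α (mix t P Q)) (Icc 0 1) := by
  intro s hs
  rw [Metric.continuousWithinAt_iff]
  intro ε hε
  obtain ⟨δ, hδ, hball⟩ := hα _ (h.mix_mem hP hQ hs.1 hs.2) ε hε
  have hlim : Tendsto (fun t => ENNReal.ofReal (|t - s| * (∫ y, ω y ∂P + ∫ y, ω y ∂Q))) (𝓝 s)
      (𝓝 (ENNReal.ofReal (|s - s| * (∫ y, ω y ∂P + ∫ y, ω y ∂Q)))) :=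
    (ENNReal.continuous_ofReal.comp (by fun_prop : Continuous fun t =>
      |t - s| * (∫ y, ω y ∂P + ∫ y, ω y ∂Q))).tendsto s
  have hev := hlim.eventually_lt_const (u := δ) (by simpa using hδ)
  obtain ⟨η, hη, hηs⟩ := Metric.eventually_nhds_iff.1 hev
  refine ⟨η, hη, fun t ht hts => ?_⟩
  exact hball _ (h.mix_mem hP hQ ht.1 ht.2)
    ((h.weightedDist_mix_le hωm hω hP hQ hs.1 hs.2 ht.1 ht.2).trans_lt (hηs hts))

/-- Intermediate values of `α` are attained on the segment between two members of the class. -/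
theorem ContinuousFunctional.exists_mix_eq (hα : ContinuousFunctional ω 𝓒 α)
    (h : AdmissibleClass ω 𝓒) (hωm : Measurable ω) (hω : ∀ y, 1 ≤ ω y)
    {P Q : Measure ℝ} (hP : P ∈ 𝓒) (hQ : Q ∈ 𝓒) {x : ℝ} (hx : x ∈ Icc (α P) (α Q)) :
    ∃ t ∈ Icc (0 : ℝ) 1, α (mix t P Q) = x := by
  have := intermediate_value_Icc zero_le_one (hα.continuousOn_mix h hωm hω hP hQ)
  simp only [mix_zero, mix_one] at this
  exact this hx

theorem ContinuousFunctional.ordConnected_image (hα : ContinuousFunctional ω 𝓒 α)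
    (h : AdmissibleClass ω 𝓒) (hωm : Measurable ω) (hω : ∀ y, 1 ≤ ω y) :
    OrdConnected (α '' 𝓒) := by
  refine ⟨?_⟩
  rintro _ ⟨P, hP, rfl⟩ _ ⟨Q, hQ, rfl⟩ x hx
  obtain ⟨t, ht, rfl⟩ := hα.exists_mix_eq h hωm hω hP hQ hx
  exact ⟨_, h.mix_mem hP hQ ht.1 ht.2, rfl⟩

namespace IsConsistentLoss

theorem integrable_sub (hL : IsConsistentLoss 𝓒 α L) {P : Measure ℝ} (hP : P ∈ 𝓒) (u v : ℝ) :
    Integrable (fun y => L u y - L v y) P :=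
  (hL.integrable P hP u).sub (hL.integrable P hP v)

/-- Order sensitivity: the expected loss strictly increases to the right of `α P`. -/
theorem integral_sub_neg (hL : IsConsistentLoss 𝓒 α L) (hα : ContinuousFunctional ω 𝓒 α)
    (h : AdmissibleClass ω 𝓒) (hωm : Measurable ω) (hω : ∀ y, 1 ≤ ω y)
    {P : Measure ℝ} (hP : P ∈ 𝓒) {u v : ℝ} (hPu : α P ≤ u) (huv : u < v) (hv : v ∈ α '' 𝓒) :
    ∫ y, (L u y - L v y) ∂P < 0 := by
  obtain ⟨Q, hQ, rfl⟩ := hv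
  obtain ⟨t, ht, htu⟩ := hα.exists_mix_eq h hωm hω hP hQ ⟨hPu, huv.le⟩
  have hR := h.mix_mem hP hQ ht.1 ht.2
  have h1 := hL.lt_of_ne _ hR (α Q) (by rw [htu]; exact huv.ne')
  rw [htu, ← sub_neg, ← integral_sub (hL.integrable _ hR _) (hL.integrable _ hR _),
    integral_mix (hL.integrable_sub hP _ _) (hL.integrable_sub hQ _ _) ht.1 ht.2] at h1
  have h2 := hL.lt_of_ne Q hQ u huv.ne
  rw [← sub_pos, ← integral_sub (hL.integrable _ hQ _) (hL.integrable _ hQ _)] at h2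
  by_contra! h3
  have := mul_nonneg (sub_nonneg.2 ht.2) h3
  have := mul_nonneg ht.1 h2.le
  linarith

/-- Order sensitivity: the expected loss strictly decreases to the left of `α P`. -/
theorem integral_sub_pos (hL : IsConsistentLoss 𝓒 α L) (hα : ContinuousFunctional ω 𝓒 α)
    (h : AdmissibleClass ω 𝓒) (hωm : Measurable ω) (hω : ∀ y, 1 ≤ ω y)
    {P : Measure ℝ} (hP : P ∈ 𝓒) {u v : ℝ} (hu : u ∈ α '' 𝓒) (huv : u < v) (hPv : v ≤ α P) :
    0 < ∫ y, (L u y - L v y) ∂P := by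
  obtain ⟨Q, hQ, rfl⟩ := hu
  obtain ⟨t, ht, htu⟩ := hα.exists_mix_eq h hωm hω hQ hP ⟨huv.le, hPv⟩
  have hR := h.mix_mem hQ hP ht.1 ht.2
  have h1 := hL.lt_of_ne _ hR (α Q) (by rw [htu]; exact huv.ne)
  rw [htu, ← sub_pos, ← integral_sub (hL.integrable _ hR _) (hL.integrable _ hR _),
    integral_mix (hL.integrable_sub hQ _ _) (hL.integrable_sub hP _ _) ht.1 ht.2] at h1
  have h2 := hL.lt_of_ne Q hQ v huv.ne'
  rw [← sub_neg, ← integral_sub (hL.integrable _ hQ _) (hL.integrable _ hQ _)] at h2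
  by_contra! h3
  have := mul_nonpos_of_nonneg_of_nonpos ht.1 h3
  have := mul_nonpos_of_nonneg_of_nonpos (sub_nonneg.2 ht.2) h2.le
  linarith

end IsConsistentLoss

end

/-! ### Two-sided bounds and level sets -/

section

/-- The standing assumptions: `ω ≥ 1` is a weight, `𝓒` is a rich convex class, and `α` is a
continuous, locally nonconstant functional for which the loss function `L` is consistent. -/
structure IsRegularlyElicited (ω : ℝ → ℝ) (𝓒 : Set (Measure ℝ)) (α : Measure ℝ → ℝ)
    (L : ℝ → ℝ → ℝ) : Prop where
  measurable_weight : Measurable ω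
  one_le_weight : ∀ y, 1 ≤ ω y
  admissible : AdmissibleClass ω 𝓒
  continuous : ContinuousFunctional ω 𝓒 α
  nonconstant : LocallyNonconstant ω 𝓒 α
  loss : IsConsistentLoss 𝓒 α L

namespace IsRegularlyElicited

variable {ω : ℝ → ℝ} {𝓒 : Set (Measure ℝ)} {α : Measure ℝ → ℝ} {L : ℝ → ℝ → ℝ}

theorem mix_mem (H : IsRegularlyElicited ω 𝓒 α L) {P Q : Measure ℝ} (hP : P ∈ 𝓒) (hQ : Q ∈ 𝓒)
    {t : ℝ} (h0 : 0 ≤ t) (h1 : t ≤ 1) : mix t P Q ∈ 𝓒 :=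
  H.admissible.mix_mem hP hQ h0 h1

theorem ordConnected_image (H : IsRegularlyElicited ω 𝓒 α L) : OrdConnected (α '' 𝓒) :=
  H.continuous.ordConnected_image H.admissible H.measurable_weight H.one_le_weight

theorem exists_mix_eq (H : IsRegularlyElicited ω 𝓒 α L) {P Q : Measure ℝ} (hP : P ∈ 𝓒)
    (hQ : Q ∈ 𝓒) {x : ℝ} (hx : x ∈ Icc (α P) (α Q)) :
    ∃ t ∈ Icc (0 : ℝ) 1, α (mix t P Q) = x :=
  H.continuous.exists_mix_eq H.admissible H.measurable_weight H.one_le_weight hP hQ hx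

theorem integral_sub_neg (H : IsRegularlyElicited ω 𝓒 α L) {P : Measure ℝ} (hP : P ∈ 𝓒) {u v : ℝ}
    (hPu : α P ≤ u) (huv : u < v) (hv : v ∈ α '' 𝓒) : ∫ y, (L u y - L v y) ∂P < 0 :=
  H.loss.integral_sub_neg H.continuous H.admissible H.measurable_weight H.one_le_weight
    hP hPu huv hv

theorem integral_sub_pos (H : IsRegularlyElicited ω 𝓒 α L) {P : Measure ℝ} (hP : P ∈ 𝓒) {u v : ℝ}
    (hu : u ∈ α '' 𝓒) (huv : u < v) (hPv : v ≤ α P) : 0 < ∫ y, (L u y - L v y) ∂P :=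
  H.loss.integral_sub_pos H.continuous H.admissible H.measurable_weight H.one_le_weight
    hP hu huv hPv

theorem integral_sub_mix (H : IsRegularlyElicited ω 𝓒 α L) {P Q : Measure ℝ} (hP : P ∈ 𝓒)
    (hQ : Q ∈ 𝓒) (u v : ℝ) {t : ℝ} (h0 : 0 ≤ t) (h1 : t ≤ 1) :
    ∫ y, (L u y - L v y) ∂(mix t P Q)
      = (1 - t) * ∫ y, (L u y - L v y) ∂P + t * ∫ y, (L u y - L v y) ∂Q :=
  integral_mix (H.loss.integrable_sub hP u v) (H.loss.integrable_sub hQ u v) h0 h1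

/-- If `α P₀ < a ≤ u < v ≤ b < α P₁`, then `|L u - L v|` is bounded by the weight times the
expected loss difference under either reference distribution, with one constant for all `u, v`
and all members of the class. -/
theorem exists_abs_sub_le (H : IsRegularlyElicited ω 𝓒 α L) {P₀ P₁ : Measure ℝ} (hP₀ : P₀ ∈ 𝓒)
    (hP₁ : P₁ ∈ 𝓒) {a b : ℝ} (ha : α P₀ < a) (hb : b < α P₁) (hab : a ≤ b) :
    ∃ C : ℝ, 0 < C ∧ ∀ u v, a ≤ u → u < v → v ≤ b → ∀ P ∈ 𝓒, ∀ᵐ y ∂P,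
      |L u y - L v y| ≤ C * (∫ z, (L u z - L v z) ∂P₁) * ω y ∧
      |L u y - L v y| ≤ C * (-∫ z, (L u z - L v z) ∂P₀) * ω y := by
  have hI : ∀ x, a ≤ x → x ≤ b → x ∈ α '' 𝓒 := fun x h1 h2 =>
    H.ordConnected_image.out ⟨P₀, hP₀, rfl⟩ ⟨P₁, hP₁, rfl⟩ ⟨ha.le.trans h1, h2.trans hb.le⟩
  obtain ⟨δ₀, hδ₀, hball₀⟩ := H.continuous P₀ hP₀ (a - α P₀) (by linarith)
  obtain ⟨δ₁, hδ₁, hball₁⟩ := H.continuous P₁ hP₁ (α P₁ - b) (by linarith)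
  obtain ⟨C₀, hC₀, hbd₀⟩ := H.admissible.exists_ae_le_of_forall_weightedDist_lt
    H.measurable_weight H.one_le_weight hP₀ hδ₀
  obtain ⟨C₁, hC₁, hbd₁⟩ := H.admissible.exists_ae_le_of_forall_weightedDist_lt
    H.measurable_weight H.one_le_weight hP₁ hδ₁
  obtain ⟨s, hs, hsa⟩ := H.exists_mix_eq hP₀ hP₁ (x := a) ⟨ha.le, by linarith⟩
  obtain ⟨t, ht, htb⟩ := H.exists_mix_eq hP₀ hP₁ (x := b) ⟨by linarith, hb.le⟩
  have hs0 : 0 < s := hs.1.lt_of_ne (by rintro rfl; simp at hsa; linarith)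
  have ht1 : t < 1 := ht.2.lt_of_ne (by rintro rfl; simp at htb; linarith)
  have ht1' : 0 < 1 - t := by linarith
  refine ⟨(C₀ + C₁) * (1 / (1 - t) + 1 / s + 1), by positivity, fun u v hu huv hv P hP => ?_⟩
  set G₀ := ∫ y, (L u y - L v y) ∂P₀ with hG₀
  set G₁ := ∫ y, (L u y - L v y) ∂P₁ with hG₁
  have huI := hI u hu (by linarith)
  have hvI := hI v (by linarith) hv
  have hneg₀ : G₀ < 0 := H.integral_sub_neg hP₀ (by linarith) huv hvI
  have hpos₁ : 0 < G₁ := H.integral_sub_pos hP₁ huI huv (by linarith)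
  -- The crossings of the levels `a` and `b` on the segment compare the two reference values.
  have h1 : -G₀ ≤ 1 / (1 - t) * G₁ := by
    have := H.integral_sub_pos (H.mix_mem hP₀ hP₁ ht.1 ht.2) huI huv (by rw [htb]; exact hv)
    rw [H.integral_sub_mix hP₀ hP₁ u v ht.1 ht.2, ← hG₀, ← hG₁] at this
    rw [one_div, ← div_eq_inv_mul, le_div_iff₀ ht1']
    nlinarith
  have h2 : G₁ ≤ 1 / s * (-G₀) := by
    have := H.integral_sub_neg (H.mix_mem hP₀ hP₁ hs.1 hs.2) (by rw [hsa]; exact hu) huv hvI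
    rw [H.integral_sub_mix hP₀ hP₁ u v hs.1 hs.2, ← hG₀, ← hG₁] at this
    rw [one_div, ← div_eq_inv_mul, le_div_iff₀ hs0]
    nlinarith [hs.2]
  have up := hbd₀ (fun y => L u y - L v y) (fun Q hQ => H.loss.integrable_sub hQ u v)
    (fun Q hQ hd => (H.integral_sub_neg hQ (by
      have := (abs_lt.1 (hball₀ Q hQ hd)).2; linarith) huv hvI).le) P hP
  have low := hbd₁ (fun y => L v y - L u y) (fun Q hQ => H.loss.integrable_sub hQ v u)
    (fun Q hQ hd => by
      have h3 := H.integral_sub_pos hQ huI huv (by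
        have := (abs_lt.1 (hball₁ Q hQ hd)).1; linarith)
      have : ∫ y, (L v y - L u y) ∂Q = -∫ y, (L u y - L v y) ∂Q := by
        rw [← integral_neg]; simp
      rw [this]; linarith) P hP
  have e : -∫ y, (L v y - L u y) ∂P₁ = G₁ := by
    rw [← integral_neg]; simp [hG₁]
  rw [e] at low
  rw [← hG₀] at up
  filter_upwards [up, low] with y h3 h4
  have hωy : 0 < ω y := zero_lt_one.trans_le (H.one_le_weight y)
  set κ := 1 / (1 - t)
  set σ := 1 / s
  have hκ : 0 < κ := by positivity
  have hσ : 0 < σ := by positivity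
  have p1 : C₁ * G₁ ≤ (C₀ + C₁) * (κ + σ + 1) * G₁ := by
    gcongr; nlinarith [mul_pos hC₁ hκ, mul_pos hC₁ hσ, mul_pos hC₀ hκ, mul_pos hC₀ hσ]
  have p2 : C₀ * -G₀ ≤ (C₀ + C₁) * (κ + σ + 1) * -G₀ := by
    have : 0 ≤ -G₀ := by linarith
    gcongr; nlinarith [mul_pos hC₁ hκ, mul_pos hC₁ hσ, mul_pos hC₀ hκ, mul_pos hC₀ hσ]
  have p3 : C₀ * -G₀ ≤ (C₀ + C₁) * (κ + σ + 1) * G₁ := by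
    refine (mul_le_mul_of_nonneg_left h1 hC₀.le).trans ?_
    rw [← mul_assoc]
    gcongr <;> linarith
  have p4 : C₁ * G₁ ≤ (C₀ + C₁) * (κ + σ + 1) * -G₀ := by
    refine (mul_le_mul_of_nonneg_left h2 hC₁.le).trans ?_
    have : 0 ≤ -G₀ := by linarith
    rw [← mul_assoc]
    gcongr <;> linarith
  have q1 := mul_le_mul_of_nonneg_right p1 hωy.le
  have q2 := mul_le_mul_of_nonneg_right p2 hωy.le
  have q3 := mul_le_mul_of_nonneg_right p3 hωy.le
  have q4 := mul_le_mul_of_nonneg_right p4 hωy.le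
  constructor <;> rw [abs_le] <;> constructor <;> linarith

/-- A member `M` of the class whose expected loss differences at `x = α M` are uniformly bounded
away from zero, relative to a normalization `N`, would have a neighbourhood on which `α` is
constant. -/
theorem not_uniform_gap (H : IsRegularlyElicited ω 𝓒 α L) {M : Measure ℝ} (hM : M ∈ 𝓒)
    {a b : ℝ} (haI : a ∈ α '' 𝓒) (hbI : b ∈ α '' 𝓒) (ha : a < α M) (hb : α M < b)
    {N : ℝ → ℝ → ℝ} {C c : ℝ} (hC : 0 < C) (hc : 0 < c)
    (hN : ∀ u v, a ≤ u → u < v → v ≤ b → 0 < N u v)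
    (hbd : ∀ u v, a ≤ u → u < v → v ≤ b → ∀ P ∈ 𝓒, ∀ᵐ y ∂P, |L u y - L v y| ≤ C * N u v * ω y)
    (hright : ∀ v, α M < v → v ≤ b → ∫ y, (L (α M) y - L v y) ∂M ≤ -(c * N (α M) v))
    (hleft : ∀ u, a ≤ u → u < α M → c * N u (α M) ≤ ∫ y, (L u y - L (α M) y) ∂M) : False := by
  have hint : α M ∈ interior (α '' 𝓒) :=
    mem_interior.2 ⟨Ioo a b, Ioo_subset_Icc_self.trans (H.ordConnected_image.out haI hbI),
      isOpen_Ioo, ha, hb⟩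
  have := H.admissible.isProbabilityMeasure M hM
  obtain ⟨Q, hQ, hd, hne⟩ := H.nonconstant M hM hint (ENNReal.ofReal (c / (2 * C)))
    (ENNReal.ofReal_pos.2 (by positivity))
  have := H.admissible.isProbabilityMeasure Q hQ
  have hclose : ∀ u v, a ≤ u → u < v → v ≤ b →
      |∫ y, (L u y - L v y) ∂M - ∫ y, (L u y - L v y) ∂Q| ≤ c / 2 * N u v := by
    intro u v h1 h2 h3
    have := abs_integral_sub_le_of_weightedDist_lt (H.admissible.absolutelyContinuous M hM)
      (H.admissible.absolutelyContinuous Q hQ) (mul_pos hC (hN u v h1 h2 h3)).le (by positivity)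
      (H.loss.integrable_sub hM u v) (H.loss.integrable_sub hQ u v) (hbd u v h1 h2 h3 M hM)
      (hbd u v h1 h2 h3 Q hQ) hd
    refine this.trans_eq ?_
    field_simp
  rcases lt_or_gt_of_ne hne with hlt | hgt
  · have h1 : max (α Q) a < α M := max_lt hlt ha
    have hmem : max (α Q) a ∈ α '' 𝓒 := by
      rcases max_choice (α Q) a with h | h <;> rw [h]
      exacts [⟨Q, hQ, rfl⟩, haI]
    have h2 := H.integral_sub_neg hQ (le_max_left _ a) h1 ⟨M, hM, rfl⟩
    have h3 := (abs_le.1 (hclose _ _ (le_max_right (α Q) a) h1 hb.le)).2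
    have h4 := hleft _ (le_max_right (α Q) a) h1
    have := mul_pos hc (hN _ _ (le_max_right (α Q) a) h1 hb.le)
    linarith
  · have h1 : α M < min (α Q) b := lt_min hgt hb
    have hmem : min (α Q) b ∈ α '' 𝓒 := by
      rcases min_choice (α Q) b with h | h <;> rw [h]
      exacts [⟨Q, hQ, rfl⟩, hbI]
    have h2 := H.integral_sub_pos hQ ⟨M, hM, rfl⟩ h1 (min_le_left _ b)
    have h3 := (abs_le.1 (hclose _ _ ha.le h1 (min_le_right (α Q) b))).1
    have h4 := hright _ h1 (min_le_right (α Q) b)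
    have := mul_pos hc (hN _ _ ha.le h1 (min_le_right (α Q) b))
    linarith

/-- An interior level lies strictly between the values of two members, with room to spare. -/
theorem exists_between_of_mem_interior {x : ℝ} (hx : x ∈ interior (α '' 𝓒)) :
    ∃ P₀ ∈ 𝓒, ∃ P₁ ∈ 𝓒, ∃ a b : ℝ, α P₀ < a ∧ a < x ∧ x < b ∧ b < α P₁ := by
  obtain ⟨ε, hε, hball⟩ := Metric.mem_nhds_iff.1 (mem_interior_iff_mem_nhds.1 hx)
  rw [Real.ball_eq_Ioo] at hball
  obtain ⟨P₀, hP₀, h₀⟩ := hball (show x - ε / 2 ∈ Ioo (x - ε) (x + ε) from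
    ⟨by linarith, by linarith⟩)
  obtain ⟨P₁, hP₁, h₁⟩ := hball (show x + ε / 2 ∈ Ioo (x - ε) (x + ε) from
    ⟨by linarith, by linarith⟩)
  exact ⟨P₀, hP₀, P₁, hP₁, x - ε / 4, x + ε / 4, by linarith,
    by linarith, by linarith, by linarith⟩

/-- Moving from the level set `{α = x}` towards a member with a larger value leaves the level
set at once.  Otherwise a segment of positive length towards `P₁` lies in the level set, and the
order sensitivity at its two ends gives a uniform gap at its midpoint. -/
theorem lt_mix (H : IsRegularlyElicited ω 𝓒 α L) {M P₁ : Measure ℝ} (hM : M ∈ 𝓒) (hP₁ : P₁ ∈ 𝓒)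
    (hint : α M ∈ interior (α '' 𝓒)) (h : α M < α P₁) {t : ℝ} (h0 : 0 < t) (h1 : t ≤ 1) :
    α M < α (mix t M P₁) := by
  obtain ⟨P₀, hP₀, -, -, a, -, ha, haM, -, -⟩ := exists_between_of_mem_interior hint
  obtain ⟨b, hMb, hb⟩ := exists_between h
  have hI : ∀ x, a ≤ x → x ≤ b → x ∈ α '' 𝓒 := fun x h1 h2 =>
    H.ordConnected_image.out ⟨P₀, hP₀, rfl⟩ ⟨P₁, hP₁, rfl⟩ ⟨ha.le.trans h1, h2.trans hb.le⟩
  have haI := hI a le_rfl (by linarith)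
  have hbI := hI b (by linarith) le_rfl
  obtain ⟨C, hC, hbd⟩ := H.exists_abs_sub_le hP₀ hP₁ ha hb (by linarith)
  by_contra! hle
  -- By order sensitivity `α` cannot drop below `α M` on the segment.
  have hle1 : ∀ s, 0 ≤ s → s ≤ 1 → α M ≤ α (mix s M P₁) := by
    intro s hs hs1
    by_contra! hlt
    have e1 := H.integral_sub_neg (H.mix_mem hM hP₁ hs hs1) le_rfl hlt ⟨M, hM, rfl⟩
    have hm : α (mix s M P₁) ∈ α '' 𝓒 := ⟨_, H.mix_mem hM hP₁ hs hs1, rfl⟩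
    have e2 := H.integral_sub_pos hM hm hlt le_rfl
    have e3 := H.integral_sub_pos hP₁ hm hlt h.le
    rw [H.integral_sub_mix hM hP₁ _ _ hs hs1] at e1
    nlinarith [mul_nonneg (sub_nonneg.2 hs1) e2.le, mul_nonneg hs e3.le]
  have hend := H.mix_mem hM hP₁ h0.le h1
  have hmid := H.mix_mem hM hP₁ (t := t / 2) (by linarith) (by linarith)
  have hmid_eq : α (mix (t / 2) M P₁) = α M := by
    refine le_antisymm ?_ (hle1 _ (by linarith) (by linarith))
    by_contra! hlt
    have e1 := H.integral_sub_pos hmid ⟨M, hM, rfl⟩ hlt le_rfl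
    have hm : α (mix (t / 2) M P₁) ∈ α '' 𝓒 := ⟨_, hmid, rfl⟩
    have e2 := H.integral_sub_neg hM le_rfl hlt hm
    have e3 := H.integral_sub_neg hend hle hlt hm
    rw [H.integral_sub_mix hM hP₁ _ _ (t := t / 2) (by linarith) (by linarith)] at e1
    rw [H.integral_sub_mix hM hP₁ _ _ h0.le h1] at e3
    linarith
  refine H.not_uniform_gap hmid (a := a) (b := b) (N := fun u v => ∫ y, (L u y - L v y) ∂P₁)
    haI hbI
    (by rw [hmid_eq]; exact haM) (by rw [hmid_eq]; exact hMb) hC (half_pos h0) ?_ ?_ ?_ ?_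
  · intro u v hu huv hv
    exact H.integral_sub_pos hP₁ (hI u hu (by linarith)) huv (by linarith)
  · intro u v hu huv hv P hP
    filter_upwards [hbd u v hu huv hv P hP] with y hy using hy.1
  · intro v hv hvb
    rw [hmid_eq] at hv ⊢
    have hvI := hI v (by linarith) hvb
    have e2 := H.integral_sub_neg hM le_rfl hv hvI
    have e3 := H.integral_sub_neg hend hle hv hvI
    rw [H.integral_sub_mix hM hP₁ _ _ h0.le h1] at e3
    rw [H.integral_sub_mix hM hP₁ _ _ (t := t / 2) (by linarith) (by linarith)]
    nlinarith
  · intro u hu huv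
    rw [hmid_eq] at huv ⊢
    have huI := hI u hu (by linarith)
    have e2 := H.integral_sub_pos hM huI huv le_rfl
    rw [H.integral_sub_mix hM hP₁ _ _ (t := t / 2) (by linarith) (by linarith)]
    nlinarith

/-- Moving from the level set `{α = x}` towards a member with a smaller value leaves the level
set at once. -/
theorem mix_lt (H : IsRegularlyElicited ω 𝓒 α L) {M P₀ : Measure ℝ} (hM : M ∈ 𝓒) (hP₀ : P₀ ∈ 𝓒)
    (hint : α M ∈ interior (α '' 𝓒)) (h : α P₀ < α M) {t : ℝ} (h0 : 0 < t) (h1 : t ≤ 1) :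
    α (mix t M P₀) < α M := by
  obtain ⟨-, -, P₁, hP₁, -, b, -, -, hMb, hb⟩ := exists_between_of_mem_interior hint
  obtain ⟨a, ha, haM⟩ := exists_between h
  have hI : ∀ x, a ≤ x → x ≤ b → x ∈ α '' 𝓒 := fun x h1 h2 =>
    H.ordConnected_image.out ⟨P₀, hP₀, rfl⟩ ⟨P₁, hP₁, rfl⟩ ⟨ha.le.trans h1, h2.trans hb.le⟩
  have haI := hI a le_rfl (by linarith)
  have hbI := hI b (by linarith) le_rfl
  obtain ⟨C, hC, hbd⟩ := H.exists_abs_sub_le hP₀ hP₁ ha hb (by linarith)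
  by_contra! hle
  have hle1 : ∀ s, 0 ≤ s → s ≤ 1 → α (mix s M P₀) ≤ α M := by
    intro s hs hs1
    by_contra! hlt
    have e1 := H.integral_sub_pos (H.mix_mem hM hP₀ hs hs1) ⟨M, hM, rfl⟩ hlt le_rfl
    have hm : α (mix s M P₀) ∈ α '' 𝓒 := ⟨_, H.mix_mem hM hP₀ hs hs1, rfl⟩
    have e2 := H.integral_sub_neg hM le_rfl hlt hm
    have e3 := H.integral_sub_neg hP₀ h.le hlt hm
    rw [H.integral_sub_mix hM hP₀ _ _ hs hs1] at e1
    nlinarith [mul_nonpos_of_nonneg_of_nonpos (sub_nonneg.2 hs1) e2.le,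
      mul_nonpos_of_nonneg_of_nonpos hs e3.le]
  have hend := H.mix_mem hM hP₀ h0.le h1
  have hmid := H.mix_mem hM hP₀ (t := t / 2) (by linarith) (by linarith)
  have hmid_eq : α (mix (t / 2) M P₀) = α M := by
    refine le_antisymm (hle1 _ (by linarith) (by linarith)) ?_
    by_contra! hlt
    have hm : α (mix (t / 2) M P₀) ∈ α '' 𝓒 := ⟨_, hmid, rfl⟩
    have e1 := H.integral_sub_neg hmid le_rfl hlt ⟨M, hM, rfl⟩
    have e2 := H.integral_sub_pos hM hm hlt le_rfl
    have e3 := H.integral_sub_pos hend hm hlt hle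
    rw [H.integral_sub_mix hM hP₀ _ _ (t := t / 2) (by linarith) (by linarith)] at e1
    rw [H.integral_sub_mix hM hP₀ _ _ h0.le h1] at e3
    linarith
  refine H.not_uniform_gap hmid (a := a) (b := b) (N := fun u v => -∫ y, (L u y - L v y) ∂P₀)
    haI hbI
    (by rw [hmid_eq]; exact haM) (by rw [hmid_eq]; exact hMb) hC (half_pos h0) ?_ ?_ ?_ ?_
  · intro u v hu huv hv
    exact neg_pos.2 (H.integral_sub_neg hP₀ (by linarith) huv (hI v (by linarith) hv))
  · intro u v hu huv hv P hP
    filter_upwards [hbd u v hu huv hv P hP] with y hy using hy.2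
  · intro v hv hvb
    rw [hmid_eq] at hv ⊢
    have hvI := hI v (by linarith) hvb
    have e2 := H.integral_sub_neg hM le_rfl hv hvI
    rw [H.integral_sub_mix hM hP₀ _ _ (t := t / 2) (by linarith) (by linarith)]
    nlinarith
  · intro u hu huv
    rw [hmid_eq] at huv ⊢
    have huI := hI u hu (by linarith)
    have e2 := H.integral_sub_pos hM huI huv le_rfl
    have e3 := H.integral_sub_pos hend huI huv hle
    rw [H.integral_sub_mix hM hP₀ _ _ h0.le h1] at e3
    rw [H.integral_sub_mix hM hP₀ _ _ (t := t / 2) (by linarith) (by linarith)]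
    nlinarith

end IsRegularlyElicited

end

/-! ### Linear functionals with the sign of `α - x` -/

section

namespace IsRegularlyElicited

variable {ω : ℝ → ℝ} {𝓒 : Set (Measure ℝ)} {α : Measure ℝ → ℝ} {L : ℝ → ℝ → ℝ}

theorem exists_mix_eq_of_lt (H : IsRegularlyElicited ω 𝓒 α L) {P Q : Measure ℝ} (hP : P ∈ 𝓒)
    (hQ : Q ∈ 𝓒) {x : ℝ} (hPx : α P < x) (hxQ : x < α Q) :
    ∃ t : ℝ, 0 < t ∧ t < 1 ∧ α (mix t P Q) = x := by
  obtain ⟨t, ht, hx⟩ := H.exists_mix_eq hP hQ ⟨hPx.le, hxQ.le⟩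
  refine ⟨t, ht.1.lt_of_ne ?_, ht.2.lt_of_ne ?_, hx⟩ <;> rintro rfl <;> simp at hx <;> linarith

/-- Linear functionals which asymptotically have the sign of `α - x`, and which are bounded at
two members of the class on either side of the level set `{α = x}`, tend to zero on it. -/
theorem tendsto_zero_of_sign (H : IsRegularlyElicited ω 𝓒 α L) {x : ℝ} {f : ℕ → ℝ → ℝ}
    (hf : ∀ n, ∀ P ∈ 𝓒, Integrable (f n) P)
    (hneg : ∀ P ∈ 𝓒, α P < x → ∀ᶠ n in atTop, ∫ y, f n y ∂P ≤ 0)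
    (hpos : ∀ P ∈ 𝓒, x < α P → ∀ᶠ n in atTop, 0 ≤ ∫ y, f n y ∂P)
    {P₀ P₁ : Measure ℝ} (hP₀ : P₀ ∈ 𝓒) (hP₁ : P₁ ∈ 𝓒) (h₀ : α P₀ < x) (h₁ : x < α P₁) {B : ℝ}
    (hB₀ : ∀ᶠ n in atTop, |∫ y, f n y ∂P₀| ≤ B) (hB₁ : ∀ᶠ n in atTop, |∫ y, f n y ∂P₁| ≤ B)
    {M : Measure ℝ} (hM : M ∈ 𝓒) (hMx : α M = x) :
    Tendsto (fun n => ∫ y, f n y ∂M) atTop (𝓝 0) := by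
  have hint : α M ∈ interior (α '' 𝓒) := by
    refine mem_interior.2 ⟨Ioo (α P₀) (α P₁), ?_, isOpen_Ioo, by rw [hMx]; exact ⟨h₀, h₁⟩⟩
    exact Ioo_subset_Icc_self.trans (H.ordConnected_image.out ⟨P₀, hP₀, rfl⟩ ⟨P₁, hP₁, rfl⟩)
  obtain ⟨n, hn⟩ := hB₀.exists
  have hB : 0 ≤ B := (abs_nonneg _).trans hn
  rw [Metric.tendsto_nhds]
  intro ε hε
  -- A small step from `M` towards `P₁` makes the functionals nonnegative, one towards `P₀` makes
  -- them nonpositive; `t` is chosen such that the step changes them by less than `ε`.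
  set t := ε / (2 * (B + ε)) with ht
  have ht0 : 0 < t := by positivity
  have htB : t * (B + ε) = ε / 2 := by rw [ht]; field_simp
  have ht1 : t < 1 := by nlinarith
  have h2 := hpos _ (H.mix_mem hM hP₁ ht0.le ht1.le)
    (by rw [← hMx]; exact H.lt_mix hM hP₁ hint (by rw [hMx]; exact h₁) ht0 ht1.le)
  have h3 := hneg _ (H.mix_mem hM hP₀ ht0.le ht1.le)
    (by rw [← hMx]; exact H.mix_lt hM hP₀ hint (by rw [hMx]; exact h₀) ht0 ht1.le)
  filter_upwards [h2, h3, hB₀, hB₁] with n h2 h3 h4 h5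
  rw [integral_mix (hf n M hM) (hf n _ hP₁) ht0.le ht1.le] at h2
  rw [integral_mix (hf n M hM) (hf n _ hP₀) ht0.le ht1.le] at h3
  rw [Real.dist_eq, sub_zero, abs_lt]
  rw [abs_le] at h4 h5
  have e1 := mul_le_mul_of_nonneg_left h5.2 ht0.le
  have e2 := mul_le_mul_of_nonneg_left h4.1 ht0.le
  constructor <;> nlinarith

/-- If expectations tend to zero at a point of the segment from `P` to `Q` and converge at `Q`, then
they converge at `P`. -/
theorem tendsto_of_mix {f : ℕ → ℝ → ℝ} {P Q : Measure ℝ} (hP : ∀ n, Integrable (f n) P)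
    (hQ : ∀ n, Integrable (f n) Q) {t d : ℝ} (h0 : 0 ≤ t) (h1 : t < 1)
    (h : Tendsto (fun n => ∫ y, f n y ∂(mix t P Q)) atTop (𝓝 0))
    (hd : Tendsto (fun n => ∫ y, f n y ∂Q) atTop (𝓝 d)) :
    Tendsto (fun n => ∫ y, f n y ∂P) atTop (𝓝 (-(t / (1 - t)) * d)) := by
  have := (h.sub (hd.const_mul t)).const_mul (1 - t)⁻¹
  have h1' : 1 - t ≠ 0 := by linarith
  convert this using 2 with n
  · rw [integral_mix (hP n) (hQ n) h0 h1.le]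
    field_simp
    ring
  · field_simp
    ring

/-- Normalized linear functionals which asymptotically have the sign of `α - x` converge, and
their limit has the sign of `α - x`. -/
theorem exists_tendsto_of_sign (H : IsRegularlyElicited ω 𝓒 α L) {x : ℝ} {f : ℕ → ℝ → ℝ}
    (hf : ∀ n, ∀ P ∈ 𝓒, Integrable (f n) P)
    (hneg : ∀ P ∈ 𝓒, α P < x → ∀ᶠ n in atTop, ∫ y, f n y ∂P ≤ 0)
    (hpos : ∀ P ∈ 𝓒, x < α P → ∀ᶠ n in atTop, 0 ≤ ∫ y, f n y ∂P)
    {P₀ P₁ : Measure ℝ} (hP₀ : P₀ ∈ 𝓒) (hP₁ : P₁ ∈ 𝓒) (h₀ : α P₀ < x) (h₁ : x < α P₁) {B κ : ℝ}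
    (hB₀ : ∀ᶠ n in atTop, |∫ y, f n y ∂P₀| ≤ B) (hκ : 0 < κ)
    (hκ₁ : ∀ᶠ n in atTop, ∫ y, f n y ∂P₁ = κ) {P : Measure ℝ} (hP : P ∈ 𝓒) :
    ∃ l, Tendsto (fun n => ∫ y, f n y ∂P) atTop (𝓝 l) ∧
      (α P < x → l < 0) ∧ (α P = x → l = 0) ∧ (x < α P → 0 < l) := by
  have hzero : ∀ M ∈ 𝓒, α M = x → Tendsto (fun n => ∫ y, f n y ∂M) atTop (𝓝 0) :=
    fun M hM hMx => H.tendsto_zero_of_sign hf hneg hpos hP₀ hP₁ h₀ h₁ (B := max B κ)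
      (hB₀.mono fun n hn => hn.trans (le_max_left _ _))
      (hκ₁.mono fun n hn => by rw [hn, abs_of_pos hκ]; exact le_max_right _ _) hM hMx
  have hκ' : Tendsto (fun n => ∫ y, f n y ∂P₁) atTop (𝓝 κ) :=
    tendsto_const_nhds.congr' (hκ₁.mono fun n hn => hn.symm)
  have hlow : ∀ P ∈ 𝓒, α P < x → ∃ l, Tendsto (fun n => ∫ y, f n y ∂P) atTop (𝓝 l) ∧ l < 0 := by
    intro P hP hPx
    obtain ⟨t, ht0, ht1, htx⟩ := H.exists_mix_eq_of_lt hP hP₁ hPx h₁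
    refine ⟨_, tendsto_of_mix (hf · P hP) (hf · P₁ hP₁) ht0.le ht1
      (hzero _ (H.mix_mem hP hP₁ ht0.le ht1.le) htx) hκ', ?_⟩
    have : 0 < t / (1 - t) := div_pos ht0 (by linarith)
    nlinarith [mul_pos this hκ]
  rcases lt_trichotomy (α P) x with hlt | heq | hgt
  · obtain ⟨l, hl, hl0⟩ := hlow P hP hlt
    exact ⟨l, hl, fun _ => hl0, fun h => absurd h hlt.ne, fun h => absurd h hlt.not_gt⟩
  · exact ⟨0, hzero P hP heq, fun h => absurd h heq.not_lt, fun _ => rfl,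
      fun h => absurd h heq.not_gt⟩
  · obtain ⟨l₀, hl₀, hl₀neg⟩ := hlow P₀ hP₀ h₀
    obtain ⟨t, ht0, ht1, htx⟩ := H.exists_mix_eq_of_lt hP₀ hP h₀ hgt
    rw [mix_comm] at htx
    refine ⟨_, tendsto_of_mix (hf · P hP) (hf · P₀ hP₀) (by linarith) (by linarith)
      (hzero _ (H.mix_mem hP hP₀ (by linarith) (by linarith)) htx) hl₀,
      fun h => absurd h hgt.not_gt, fun h => absurd h hgt.ne', fun _ => ?_⟩
    have : 0 < (1 - t) / (1 - (1 - t)) := div_pos (by linarith) (by linarith)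
    nlinarith [mul_pos_of_neg_of_neg (neg_neg_of_pos this) hl₀neg]

/-- Two families of linear functionals which have the sign of `α - x` are proportional: if
`E_P g` has exactly this sign, then functionals which have it asymptotically and converge at one
member of the class above the level `x` converge to a multiple of `E_P g`. -/
theorem tendsto_mul_of_sign (H : IsRegularlyElicited ω 𝓒 α L) {x : ℝ} {f : ℕ → ℝ → ℝ}
    (hf : ∀ n, ∀ P ∈ 𝓒, Integrable (f n) P)
    (hneg : ∀ P ∈ 𝓒, α P < x → ∀ᶠ n in atTop, ∫ y, f n y ∂P ≤ 0)
    (hpos : ∀ P ∈ 𝓒, x < α P → ∀ᶠ n in atTop, 0 ≤ ∫ y, f n y ∂P)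
    {P₀ P₁ : Measure ℝ} (hP₀ : P₀ ∈ 𝓒) (hP₁ : P₁ ∈ 𝓒) (h₀ : α P₀ < x) (h₁ : x < α P₁)
    {g : ℝ → ℝ} (hg : ∀ P ∈ 𝓒, Integrable g P) (hg0 : ∀ P ∈ 𝓒, α P = x → ∫ y, g y ∂P = 0)
    (hg₁ : ∫ y, g y ∂P₁ ≠ 0) {B d : ℝ} (hB₀ : ∀ᶠ n in atTop, |∫ y, f n y ∂P₀| ≤ B)
    (hd : Tendsto (fun n => ∫ y, f n y ∂P₁) atTop (𝓝 d)) {P : Measure ℝ} (hP : P ∈ 𝓒) :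
    Tendsto (fun n => ∫ y, f n y ∂P) atTop (𝓝 (d / (∫ y, g y ∂P₁) * ∫ y, g y ∂P)) := by
  have hd' : ∀ᶠ n in atTop, |∫ y, f n y ∂P₁| ≤ |d| + 1 :=
    (hd.abs.eventually_lt_const (lt_add_one |d|)).mono fun n hn => hn.le
  have hzero : ∀ M ∈ 𝓒, α M = x → Tendsto (fun n => ∫ y, f n y ∂M) atTop (𝓝 0) :=
    fun M hM hMx => H.tendsto_zero_of_sign hf hneg hpos hP₀ hP₁ h₀ h₁ (B := max B (|d| + 1))
      (hB₀.mono fun n hn => hn.trans (le_max_left _ _))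
      (hd'.mono fun n hn => hn.trans (le_max_right _ _)) hM hMx
  have step : ∀ P ∈ 𝓒, ∀ Q ∈ 𝓒, ∀ t e, 0 ≤ t → t < 1 → α (mix t P Q) = x →
      Tendsto (fun n => ∫ y, f n y ∂Q) atTop (𝓝 (e * ∫ y, g y ∂Q)) →
      Tendsto (fun n => ∫ y, f n y ∂P) atTop (𝓝 (e * ∫ y, g y ∂P)) := by
    intro P hP Q hQ t e ht0 ht1 htx hQe
    have hm := H.mix_mem hP hQ ht0 ht1.le
    have := tendsto_of_mix (hf · P hP) (hf · Q hQ) ht0 ht1 (hzero _ hm htx) hQe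
    have h0 := hg0 _ hm htx
    rw [integral_mix (hg P hP) (hg Q hQ) ht0 ht1.le] at h0
    convert this using 2
    have h1' : 1 - t ≠ 0 := by linarith
    have : ∫ y, g y ∂P = -(t / (1 - t)) * ∫ y, g y ∂Q := by
      field_simp
      linarith
    rw [this]
    ring
  have hlow : ∀ P ∈ 𝓒, α P < x →
      Tendsto (fun n => ∫ y, f n y ∂P) atTop (𝓝 (d / (∫ y, g y ∂P₁) * ∫ y, g y ∂P)) := by
    intro P hP hPx
    obtain ⟨t, ht0, ht1, htx⟩ := H.exists_mix_eq_of_lt hP hP₁ hPx h₁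
    exact step P hP P₁ hP₁ t _ ht0.le ht1 htx (by rwa [div_mul_cancel₀ _ hg₁])
  rcases lt_trichotomy (α P) x with hlt | heq | hgt
  · exact hlow P hP hlt
  · rw [hg0 P hP heq, mul_zero]
    exact hzero P hP heq
  · obtain ⟨t, ht0, ht1, htx⟩ := H.exists_mix_eq_of_lt hP₀ hP h₀ hgt
    rw [mix_comm] at htx
    exact step P hP P₀ hP₀ _ _ (by linarith) (by linarith) htx (hlow P₀ hP₀ h₀)

end IsRegularlyElicited

end

/-! ### Jointly measurable weak limits -/

section

/-- A bounded sequence of jointly measurable functions whose integrals over all events converge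
has a limit that is again jointly measurable.  The limits of the integrals of `1 + k n` form a
finite kernel, whose Radon-Nikodym derivative with respect to `ν` is jointly measurable. -/
theorem exists_measurable_setIntegral_limit (ν : Measure ℝ) [IsFiniteMeasure ν]
    {k : ℕ → ℝ → ℝ → ℝ} (hk : ∀ n, Measurable (Function.uncurry (k n)))
    (hk1 : ∀ n x y, |k n x y| ≤ 1)
    (hconv : ∀ x A, MeasurableSet A → ∃ l, Tendsto (fun n => ∫ y in A, k n x y ∂ν) atTop (𝓝 l)) :
    ∃ K : ℝ → ℝ → ℝ, Measurable (Function.uncurry K) ∧ (∀ x y, |K x y| ≤ 1) ∧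
      ∀ x A, MeasurableSet A →
        Tendsto (fun n => ∫ y in A, k n x y ∂ν) atTop (𝓝 (∫ y in A, K x y ∂ν)) := by
  have hkx : ∀ n x, Measurable (k n x) := fun n x => (hk n).of_uncurry_left
  have hki : ∀ n x, Integrable (k n x) ν := fun n x =>
    Integrable.of_bound (hkx n x).aestronglyMeasurable 1 (.of_forall fun y => by
      simpa using hk1 n x y)
  -- `1 + k n` is nonnegative, so that its integrals are measures of mass at most `2 ν`.
  set a : ℕ → ℝ → Set ℝ → ℝ≥0∞ := fun n x A => ∫⁻ y in A, ENNReal.ofReal (1 + k n x y) ∂ν with ha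
  have hnn : ∀ n x y, 0 ≤ 1 + k n x y := fun n x y => by linarith [(abs_le.1 (hk1 n x y)).1]
  have ha_eq : ∀ n x A, a n x A = ENNReal.ofReal (ν.real A + ∫ y in A, k n x y ∂ν) := by
    intro n x A
    rw [ha]
    simp only
    have hi : Integrable (fun y => 1 + k n x y) ν := (integrable_const (1 : ℝ)).add (hki n x)
    rw [← ofReal_integral_eq_lintegral_ofReal hi.integrableOn (.of_forall (hnn n x)),
      integral_add (integrable_const (1 : ℝ)).integrableOn (hki n x).integrableOn]
    simp
  have ha_le : ∀ n x A, a n x A ≤ 2 * ν A := by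
    intro n x A
    calc a n x A ≤ ∫⁻ _ in A, 2 ∂ν := by
          refine lintegral_mono fun y => ?_
          rw [← ENNReal.ofReal_ofNat 2]
          exact ENNReal.ofReal_le_ofReal (by linarith [(abs_le.1 (hk1 n x y)).2])
      _ = 2 * ν A := by simp
  set m : ℝ → Set ℝ → ℝ≥0∞ := fun x A => liminf (fun n => a n x A) atTop with hm
  have hlim : ∀ x A, MeasurableSet A → Tendsto (fun n => a n x A) atTop (𝓝 (m x A)) := by
    intro x A hA
    obtain ⟨l, hl⟩ := hconv x A hA
    have : Tendsto (fun n => a n x A) atTop (𝓝 (ENNReal.ofReal (ν.real A + l))) := by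
      simp only [ha_eq]
      exact ENNReal.tendsto_ofReal (hl.const_add _)
    rw [hm]
    simp only
    rwa [this.liminf_eq]
  have hm_le : ∀ x A, MeasurableSet A → m x A ≤ 2 * ν A := fun x A hA =>
    le_of_tendsto' (hlim x A hA) fun n => ha_le n x A
  let κ₀ : ℝ → Measure ℝ := fun x => Measure.ofMeasurable (fun A _ => m x A) (by simp [hm, ha]) (by
    intro A hA hd
    have h1 := hlim x _ (MeasurableSet.iUnion hA)
    have h2 : ∀ n, a n x (⋃ i, A i) = ∑' i, a n x (A i) := fun n => lintegral_iUnion hA hd _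
    simp only [h2, ← lintegral_count] at h1
    refine tendsto_nhds_unique h1 ?_
    rw [← lintegral_count]
    refine tendsto_lintegral_of_dominated_convergence (fun i => 2 * ν (A i))
      (fun n => measurable_of_countable _) (fun n => .of_forall fun i => ha_le n x _) ?_
      (.of_forall fun i => hlim x _ (hA i))
    rw [lintegral_count, ENNReal.tsum_mul_left, ← measure_iUnion hd hA]
    exact ENNReal.mul_ne_top ENNReal.ofNat_ne_top (measure_ne_top _ _))
  have hκ₀ : ∀ x A, MeasurableSet A → κ₀ x A = m x A := fun x A hA =>
    Measure.ofMeasurable_apply A hA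
  have hmeas : Measurable κ₀ := by
    refine Measure.measurable_of_measurable_coe _ fun A hA => ?_
    simp only [hκ₀ _ A hA]
    refine Measurable.liminf fun n => ?_
    have : Measurable (Function.uncurry fun x y => ENNReal.ofReal (1 + k n x y)) :=
      ((hk n).const_add 1).ennreal_ofReal
    exact this.lintegral_prod_right'
  let κ : Kernel ℝ ℝ := ⟨κ₀, hmeas⟩
  have hκ : ∀ x A, MeasurableSet A → κ x A = m x A := hκ₀
  have hκle : ∀ x A, MeasurableSet A → κ x A ≤ 2 * ν A := fun x A hA =>
    (hκ x A hA).trans_le (hm_le x A hA)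
  have : IsFiniteKernel κ := ⟨2 * ν univ, ENNReal.mul_lt_top (by simp) (measure_lt_top _ _),
    fun x => hκle x univ .univ⟩
  have hac : ∀ x, κ x ≪ Kernel.const ℝ ν x := by
    intro x
    refine Measure.AbsolutelyContinuous.mk fun A hA h0 => ?_
    rw [Kernel.const_apply] at h0
    exact le_antisymm ((hκle x A hA).trans (by simp [h0])) zero_le
  set F : ℝ → ℝ → ℝ≥0∞ := κ.rnDeriv (Kernel.const ℝ ν) with hF
  have hFm : Measurable (Function.uncurry F) := Kernel.measurable_rnDeriv _ _
  have hFx : ∀ x, Measurable (F x) := fun x => hFm.of_uncurry_left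
  have hFint : ∀ x A, MeasurableSet A → ∫⁻ y in A, F x y ∂ν = κ x A := by
    intro x A hA
    have := Kernel.withDensity_rnDeriv_eq (hac x)
    conv_rhs => rw [← this]
    rw [Kernel.withDensity_apply' _ (Kernel.measurable_rnDeriv _ _), Kernel.const_apply]
  have hF2 : ∀ x, ∀ᵐ y ∂ν, F x y ≤ 2 := by
    intro x
    refine ae_le_of_forall_setLIntegral_le_of_sigmaFinite (hFx x) fun A hA _ => ?_
    rw [hFint x A hA]
    simpa using hκle x A hA
  -- The truncation has an effect on `ν`-null sets only, and makes the bound hold everywhere.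
  refine ⟨fun x y => max (-1) (min 1 ((F x y).toReal - 1)), ?_, ?_, ?_⟩
  · exact measurable_const.max (measurable_const.min (hFm.ennreal_toReal.sub_const 1))
  · intro x y
    rw [abs_le]
    exact ⟨le_max_left _ _, max_le (by norm_num) (min_le_left _ _)⟩
  intro x A hA
  have e1 : ∫ y in A, max (-1) (min 1 ((F x y).toReal - 1)) ∂ν
      = ∫ y in A, ((F x y).toReal - 1) ∂ν := by
    refine integral_congr_ae (ae_restrict_of_ae ?_)
    filter_upwards [hF2 x] with y hy
    have : (F x y).toReal ≤ 2 := ENNReal.toReal_le_of_le_ofReal (by norm_num) (by simpa using hy)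
    have h0 : 0 ≤ (F x y).toReal := ENNReal.toReal_nonneg
    rw [min_eq_right (by linarith), max_eq_right (by linarith)]
  have hFi : Integrable (fun y => (F x y).toReal) ν :=
    integrable_toReal_of_lintegral_ne_top (hFx x).aemeasurable (by
      rw [← setLIntegral_univ, hFint x univ .univ]; exact measure_ne_top _ _)
  have e2 : ∫ y in A, ((F x y).toReal - 1) ∂ν = (κ x A).toReal - ν.real A := by
    rw [integral_sub hFi.integrableOn (integrable_const _).integrableOn, integral_toReal
      (hFx x).aemeasurable, hFint x A hA]
    · simp
    · refine ae_restrict_of_ae ?_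
      filter_upwards [hF2 x] with y hy using hy.trans_lt (by simp)
  rw [e1, e2]
  have h3 : ∀ n, ∫ y in A, k n x y ∂ν = (a n x A).toReal - ν.real A := by
    intro n
    rw [ha_eq, ENNReal.toReal_ofReal]
    · ring
    have : ν.real A + ∫ y in A, k n x y ∂ν = ∫ y in A, (1 + k n x y) ∂ν := by
      rw [integral_add (integrable_const (1 : ℝ)).integrableOn (hki n x).integrableOn]
      simp
    rw [this]
    exact integral_nonneg (hnn n x)
  simp only [h3]
  refine Tendsto.sub_const ?_ _
  rw [hκ x A hA]
  exact (ENNReal.tendsto_toReal (ne_top_of_le_ne_top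
    (ENNReal.mul_ne_top ENNReal.ofNat_ne_top (measure_ne_top _ _)) (hm_le x A hA))).comp
    (hlim x A hA)

/-- For bounded functions, convergence of the integrals over all events implies convergence of
the integrals against all integrable functions. -/
theorem tendsto_integral_mul_of_tendsto_setIntegral {ν : Measure ℝ} [IsFiniteMeasure ν]
    {k : ℕ → ℝ → ℝ} {K : ℝ → ℝ} (hk : ∀ n, Measurable (k n)) (hK : Measurable K)
    (hk1 : ∀ n y, |k n y| ≤ 1) (hK1 : ∀ y, |K y| ≤ 1)
    (h : ∀ A, MeasurableSet A →
      Tendsto (fun n => ∫ y in A, k n y ∂ν) atTop (𝓝 (∫ y in A, K y ∂ν)))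
    {f : ℝ → ℝ} (hf : Integrable f ν) :
    Tendsto (fun n => ∫ y, f y * k n y ∂ν) atTop (𝓝 (∫ y, f y * K y ∂ν)) := by
  have hi : ∀ {f g : ℝ → ℝ}, Integrable f ν → Measurable g → (∀ y, |g y| ≤ 1) →
      Integrable (fun y => f y * g y) ν := fun hf hg hg1 =>
    hf.mul_bdd (c := 1) hg.aestronglyMeasurable (.of_forall hg1)
  refine Integrable.induction (fun f => Tendsto (fun n => ∫ y, f y * k n y ∂ν) atTop
    (𝓝 (∫ y, f y * K y ∂ν))) ?_ ?_ ?_ ?_ hf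
  · intro c A hA _
    have e : ∀ g : ℝ → ℝ, ∫ y, A.indicator (fun _ => c) y * g y ∂ν = c * ∫ y in A, g y ∂ν := by
      intro g
      rw [← integral_const_mul, ← integral_indicator hA]
      congr 1 with y
      by_cases hy : y ∈ A <;> simp [hy]
    simp only [e]
    exact (h A hA).const_mul c
  · intro f g _ hf hg h1 h2
    have e : ∀ q : ℝ → ℝ, Measurable q → (∀ y, |q y| ≤ 1) → ∫ y, (f + g) y * q y ∂ν
        = ∫ y, f y * q y ∂ν + ∫ y, g y * q y ∂ν := by
      intro q hq hq1
      rw [← integral_add (hi hf hq hq1) (hi hg hq hq1)]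
      simp only [Pi.add_apply, add_mul]
    rw [e K hK hK1]
    simp only [e _ (hk _) (hk1 _)]
    exact h1.add h2
  · refine isClosed_of_closure_subset fun f hf => ?_
    rw [Set.mem_ofPred_eq, Metric.tendsto_nhds]
    intro ε hε
    obtain ⟨g, hg, hfg⟩ := Metric.mem_closure_iff.1 hf (ε / 3) (by positivity)
    have hdist : ∀ q : ℝ → ℝ, Measurable q → (∀ y, |q y| ≤ 1) →
        |∫ y, f y * q y ∂ν - ∫ y, g y * q y ∂ν| ≤ dist f g := by
      intro q hq hq1
      have hf := L1.integrable_coeFn f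
      have hg := L1.integrable_coeFn g
      rw [← integral_sub (hi hf hq hq1) (hi hg hq hq1), L1.dist_eq_integral_dist,
        ← Real.norm_eq_abs]
      refine norm_integral_le_of_norm_le (by simpa [dist_eq_norm] using (hf.sub hg).norm)
        (.of_forall fun y => ?_)
      rw [← sub_mul, norm_mul, dist_eq_norm]
      exact mul_le_of_le_one_right (norm_nonneg _) (hq1 y)
    filter_upwards [Metric.tendsto_nhds.1 hg (ε / 3) (by positivity)] with n hn
    have h1 := hdist _ (hk n) (hk1 n)
    have h2 := hdist _ hK hK1
    rw [Real.dist_eq] at hn ⊢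
    rw [abs_lt] at hn ⊢
    rw [abs_le] at h1 h2
    constructor <;> linarith
  · intro f g hfg _ hf
    have e : ∀ q : ℝ → ℝ, ∫ y, g y * q y ∂ν = ∫ y, f y * q y ∂ν := fun q =>
      integral_congr_ae (by filter_upwards [hfg] with y hy; rw [hy])
    simpa only [e] using hf

namespace AdmissibleClass

variable {ω : ℝ → ℝ} {𝓒 : Set (Measure ℝ)}

/-- The class is dominated by countably many of its members, because the densities of its
members form a separable subset of `L¹`. -/
theorem exists_countable_dominating (h : AdmissibleClass ω 𝓒) :
    ∃ 𝓓 ⊆ 𝓒, 𝓓.Countable ∧ ∀ P ∈ 𝓒, ∀ A, MeasurableSet A → (∀ Q ∈ 𝓓, Q A = 0) → P A = 0 := by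
  have : Fact ((1 : ℝ≥0∞) ≠ ∞) := ⟨ENNReal.one_ne_top⟩
  have hfin : ∀ P : 𝓒, IsFiniteMeasure (P : Measure ℝ) := fun P => by
    have := h.isProbabilityMeasure P P.2
    infer_instance
  let d : 𝓒 → Lp ℝ 1 (volume : Measure ℝ) := fun P =>
    (Measure.integrable_toReal_rnDeriv (μ := (P : Measure ℝ)) (ν := volume)).toL1 _
  have hd : ∀ (P : 𝓒) (A : Set ℝ), ∫ y in A, d P y = (P : Measure ℝ).real A := by
    intro P A
    rw [← Measure.setIntegral_toReal_rnDeriv (h.absolutelyContinuous P P.2) A]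
    exact integral_congr_ae (ae_restrict_of_ae (Integrable.coeFn_toL1 _))
  obtain ⟨t, hts, htc, hdense⟩ :=
    (TopologicalSpace.IsSeparable.of_separableSpace (range d)).exists_countable_dense_subset
  choose g hg using fun f : t => hts f.2
  have := htc.to_subtype
  refine ⟨range fun f => (g f : Measure ℝ), ?_, countable_range _, fun P hP A hA hA0 => ?_⟩
  · rintro _ ⟨f, rfl⟩
    exact (g f).2
  have hclosed : IsClosed {f : Lp ℝ 1 (volume : Measure ℝ) | ∫ y in A, f y = 0} :=
    isClosed_eq (continuous_setIntegral A) continuous_const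
  have hsub : t ⊆ {f : Lp ℝ 1 (volume : Measure ℝ) | ∫ y in A, f y = 0} := by
    intro f hf
    have := hd (g ⟨f, hf⟩) A
    rw [hg ⟨f, hf⟩] at this
    rw [Set.mem_ofPred_eq, this, Measure.real, hA0 _ ⟨⟨f, hf⟩, rfl⟩, ENNReal.toReal_zero]
  have := h.isProbabilityMeasure P hP
  have := hclosed.closure_subset_iff.2 hsub (hdense ⟨⟨P, hP⟩, rfl⟩)
  rw [Set.mem_ofPred_eq, hd] at this
  rwa [measureReal_eq_zero_iff] at this

end AdmissibleClass

end

section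

namespace AdmissibleClass

variable {ω : ℝ → ℝ} {𝓒 : Set (Measure ℝ)}

/-- Jointly measurable functions bounded by the weight, whose expectations converge under every
member of the class, have a jointly measurable limit bounded by the weight. -/
theorem exists_measurable_integral_limit (h : AdmissibleClass ω 𝓒) (hωm : Measurable ω)
    (hω : ∀ y, 1 ≤ ω y) {k : ℕ → ℝ → ℝ → ℝ} (hk : ∀ n, Measurable (Function.uncurry (k n)))
    (hk1 : ∀ n x y, |k n x y| ≤ 1)
    (hconv : ∀ x, ∀ P ∈ 𝓒, ∃ l, Tendsto (fun n => ∫ y, ω y * k n x y ∂P) atTop (𝓝 l)) :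
    ∃ V : ℝ → ℝ → ℝ, Measurable (Function.uncurry V) ∧ (∀ x y, |V x y| ≤ ω y) ∧
      ∀ x, ∀ P ∈ 𝓒, Tendsto (fun n => ∫ y, ω y * k n x y ∂P) atTop (𝓝 (∫ y, V x y ∂P)) := by
  have h0 : ∀ y, 0 < ω y := fun y => zero_lt_one.trans_le (hω y)
  have hkx : ∀ n x, Measurable (k n x) := fun n x => (hk n).of_uncurry_left
  obtain ⟨𝓓, h𝓓, h𝓓c, hdom⟩ := h.exists_countable_dominating
  have := h𝓓c.to_subtype
  obtain ⟨c, hc, hcsum⟩ := ENNReal.exists_pos_tsum_mul_lt_of_countable one_ne_zero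
    (fun Q : 𝓓 => ENNReal.ofReal (∫ y, ω y ∂(Q : Measure ℝ))) (fun _ => ENNReal.ofReal_ne_top)
  -- A finite measure dominating the class: a weighted sum of the measures `ω Q` with `Q ∈ 𝓓`.
  let ν₀ : 𝓓 → Measure ℝ := fun Q =>
    c Q • (Q : Measure ℝ).withDensity fun y => ENNReal.ofReal (ω y)
  have hν₀univ : ∀ Q : 𝓓, ν₀ Q univ
      = ENNReal.ofReal (∫ y, ω y ∂(Q : Measure ℝ)) * c Q := by
    intro Q
    rw [Measure.coe_nnreal_smul_apply, withDensity_apply _ .univ, setLIntegral_univ,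
      h.lintegral_weight hω (h𝓓 Q.2), mul_comm]
  let ν : Measure ℝ := Measure.sum ν₀
  have hνfin : IsFiniteMeasure ν := by
    refine ⟨?_⟩
    rw [Measure.sum_apply _ .univ]
    simp only [hν₀univ]
    exact hcsum.trans_le le_top
  have hν₀fin : ∀ Q, IsFiniteMeasure (ν₀ Q) := fun Q => by
    refine ⟨?_⟩
    rw [hν₀univ]
    exact ENNReal.mul_lt_top ENNReal.ofReal_lt_top ENNReal.coe_lt_top
  have hbdd : ∀ (μ : Measure ℝ) [IsFiniteMeasure μ] n x, Integrable (k n x) μ := fun μ _ n x =>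
    Integrable.of_bound (hkx n x).aestronglyMeasurable 1 (.of_forall fun y => by
      simpa using hk1 n x y)
  have hωk : ∀ n x, ∀ P ∈ 𝓒, Integrable (fun y => ω y * k n x y) P := fun n x P hP =>
    (h.integrable_weight P hP).mul_bdd (c := 1) (hkx n x).aestronglyMeasurable
      (.of_forall (hk1 n x))
  have hν₀int : ∀ (Q : 𝓓) (A : Set ℝ), MeasurableSet A → ∀ g : ℝ → ℝ,
      ∫ y in A, g y ∂(ν₀ Q) = c Q * ∫ y in A, ω y * g y ∂(Q : Measure ℝ) := by
    intro Q A hA g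
    rw [Measure.restrict_smul, integral_smul_nnreal_measure,
      setIntegral_withDensity_eq_setIntegral_toReal_smul (by fun_prop)
        (.of_forall fun _ => ENNReal.ofReal_lt_top) _ hA, NNReal.smul_def, smul_eq_mul]
    simp only [smul_eq_mul, ENNReal.toReal_ofReal (h0 _).le]
  have hconvν : ∀ x A, MeasurableSet A →
      ∃ l, Tendsto (fun n => ∫ y in A, k n x y ∂ν) atTop (𝓝 l) := by
    intro x A hA
    have h1 : ∀ Q : 𝓓, ∃ l, Tendsto (fun n => ∫ y in A, k n x y ∂(ν₀ Q)) atTop (𝓝 l) := by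
      intro Q
      obtain ⟨R, hR, e, he⟩ := h.exists_setIntegral_eq (h𝓓 Q.2) A
      obtain ⟨l₁, h₁⟩ := hconv x R hR
      obtain ⟨l₂, h₂⟩ := hconv x Q (h𝓓 Q.2)
      simp only [hν₀int Q A hA, he _ (hωk _ x Q (h𝓓 Q.2))]
      exact ⟨_, ((h₁.const_mul e).sub h₂).const_mul _⟩
    choose l hl using h1
    have h2 : ∀ n, ∫ y in A, k n x y ∂ν = ∑' Q, ∫ y in A, k n x y ∂(ν₀ Q) := by
      intro n
      rw [Measure.restrict_sum _ hA, integral_sum_measure]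
      rw [← Measure.restrict_sum _ hA]
      exact (hbdd ν n x).integrableOn
    simp only [h2]
    refine ⟨_, tendsto_tsum_of_dominated_convergence (bound := fun Q => (ν₀ Q).real univ) ?_ hl
      (.of_forall fun n Q => ?_)⟩
    · refine ENNReal.summable_toReal ?_
      rw [← Measure.sum_apply _ .univ]
      exact measure_ne_top ν _
    · have := norm_integral_le_of_norm_le_const (μ := (ν₀ Q).restrict A) (f := k n x) (C := 1)
        (.of_forall fun y => by simpa using hk1 n x y)
      refine this.trans ?_
      rw [one_mul]
      exact measureReal_mono (μ := ν₀ Q) (subset_univ A) |>.trans' (by simp)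
  obtain ⟨K, hKm, hK1, hKlim⟩ := exists_measurable_setIntegral_limit ν hk hk1 hconvν
  refine ⟨fun x y => ω y * K x y, (hωm.comp measurable_snd).mul hKm, fun x y => ?_, ?_⟩
  · rw [abs_mul, abs_of_pos (h0 y)]
    exact mul_le_of_le_one_right (h0 y).le (hK1 x y)
  intro x P hP
  have := h.isProbabilityMeasure P hP
  have hPν : P ≪ ν := by
    refine Measure.AbsolutelyContinuous.mk fun A hA hA0 => ?_
    refine hdom P hP A hA fun Q hQ => ?_
    rw [Measure.sum_apply _ hA, ENNReal.tsum_eq_zero] at hA0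
    have h1 := hA0 ⟨Q, hQ⟩
    rw [Measure.coe_nnreal_smul_apply, mul_eq_zero, withDensity_apply _ hA] at h1
    have h2 := h1.resolve_left (by simpa using (hc ⟨Q, hQ⟩).ne')
    rw [lintegral_eq_zero_iff (by fun_prop)] at h2
    rw [← Measure.restrict_eq_zero, ← ae_eq_bot]
    refine eventually_false_iff_eq_bot.1 (h2.mono fun y hy => ?_)
    exact (ENNReal.ofReal_pos.2 (h0 y)).ne' hy
  have hint : Integrable (fun y => (P.rnDeriv ν y).toReal * ω y) ν :=
    (integrable_rnDeriv_smul_iff hPν).2 (h.integrable_weight P hP)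
  have := tendsto_integral_mul_of_tendsto_setIntegral (fun n => hkx n x) hKm.of_uncurry_left
    (fun n => hk1 n x) (hK1 x) (hKlim x) hint
  have e : ∀ g : ℝ → ℝ, ∫ y, (P.rnDeriv ν y).toReal * ω y * g y ∂ν = ∫ y, ω y * g y ∂P := by
    intro g
    rw [← integral_rnDeriv_smul hPν]
    simp only [smul_eq_mul, mul_assoc]
  simpa only [e] using this

end AdmissibleClass

end

/-! ### Construction of a function with the sign of `α - x` -/

section

/-- Measurable families with a pointwise property which exist near every point of an open set can
be glued along a countable subcover. -/
theorem exists_measurable_uncurry_of_locally {U : Set ℝ} {p : ℝ → (ℝ → ℝ) → Prop}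
    (h : ∀ x ∈ U, ∃ O : Set ℝ, IsOpen O ∧ x ∈ O ∧ ∃ V : ℝ → ℝ → ℝ,
      Measurable (Function.uncurry V) ∧ ∀ z ∈ O, p z (V z)) :
    ∃ V : ℝ → ℝ → ℝ, Measurable (Function.uncurry V) ∧ ∀ x ∈ U, p x (V x) := by
  choose O hO hxO V hV hp using fun x : U => h x x.2
  obtain ⟨T, hTc, hT⟩ := TopologicalSpace.isOpen_iUnion_countable O hO
  have hcover : ∀ x ∈ U, x ∈ ⋃ i ∈ T, O i := fun x hx => by
    rw [hT]
    exact mem_iUnion.2 ⟨⟨x, hx⟩, hxO ⟨x, hx⟩⟩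
  rcases T.eq_empty_or_nonempty with rfl | hne
  · exact ⟨0, measurable_const, fun x hx => by simpa using hcover x hx⟩
  obtain ⟨f, rfl⟩ := hTc.exists_eq_range hne
  let D : ℕ → Set ℝ := disjointed fun n => O (f n)
  have hD : ∀ n, MeasurableSet (D n) := fun n => .disjointed (fun n => (hO _).measurableSet) n
  obtain ⟨W, hW, hWD⟩ := exists_measurable_piecewise (fun n => D n ×ˢ (univ : Set ℝ))
    (fun n => (hD n).prod .univ) (fun n => Function.uncurry (V (f n))) (fun n => hV _) (by
      intro i j hij z hz
      exact (disjoint_left.1 (disjoint_disjointed (fun n => O (f n)) hij) hz.1.1 hz.2.1).elim)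
  refine ⟨Function.curry W, by simpa using hW, fun x hx => ?_⟩
  have hx' : x ∈ ⋃ n, D n := by
    rw [iUnion_disjointed]
    simpa using hcover x hx
  obtain ⟨n, hn⟩ := mem_iUnion.1 hx'
  have : Function.curry W x = V (f n) x := by
    ext y
    exact hWD n (show (x, y) ∈ D n ×ˢ univ from ⟨hn, trivial⟩)
  rw [this]
  exact hp _ _ (disjointed_subset _ n hn)

namespace IsRegularlyElicited

variable {ω : ℝ → ℝ} {𝓒 : Set (Measure ℝ)} {α : Measure ℝ → ℝ} {L : ℝ → ℝ → ℝ}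

theorem _root_.IsConsistentLoss.measurable_shift (hL : IsConsistentLoss 𝓒 α L) (c : ℝ) :
    Measurable (Function.uncurry fun x y => L (x + c) y) :=
  hL.measurable.comp ((measurable_fst.add_const c).prodMk measurable_snd)

/-- Between the values of two members of the class, normalized differences
`L x - L (x + 1 / (n + 1))` have a weak limit whose expectation has the sign of `α - x`. -/
theorem exists_sign_function_Ioo (H : IsRegularlyElicited ω 𝓒 α L) {P₀ P₁ : Measure ℝ}
    (hP₀ : P₀ ∈ 𝓒) (hP₁ : P₁ ∈ 𝓒) {a b : ℝ} (ha : α P₀ < a) (hb : b < α P₁) :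
    ∃ V : ℝ → ℝ → ℝ, Measurable (Function.uncurry V) ∧ (∀ x y, |V x y| ≤ ω y) ∧
      ∀ x ∈ Ioo a b, ∀ P ∈ 𝓒, (α P < x → ∫ y, V x y ∂P < 0) ∧ (α P = x → ∫ y, V x y ∂P = 0) ∧
        (x < α P → 0 < ∫ y, V x y ∂P) := by
  have h0 : ∀ y, 0 < ω y := fun y => zero_lt_one.trans_le (H.one_le_weight y)
  rcases le_or_gt b a with hba | hab
  · exact ⟨0, measurable_const, fun x y => by simpa using (h0 y).le,
      fun x hx => by simp [hba] at hx⟩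
  have hI : ∀ x, a ≤ x → x ≤ b → x ∈ α '' 𝓒 := fun x h1 h2 =>
    H.ordConnected_image.out ⟨P₀, hP₀, rfl⟩ ⟨P₁, hP₁, rfl⟩ ⟨ha.le.trans h1, h2.trans hb.le⟩
  have := H.admissible.isProbabilityMeasure P₁ hP₁
  obtain ⟨C, hC, hbd⟩ := H.exists_abs_sub_le hP₀ hP₁ ha hb hab.le
  set s : ℕ → ℝ := fun n => 1 / ((n : ℝ) + 1) with hs
  have hs0 : ∀ n, 0 < s n := fun n => Nat.one_div_pos_of_nat
  have hslim : Tendsto s atTop (𝓝 0) := tendsto_one_div_add_atTop_nhds_zero_nat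
  have hsx : ∀ {x z : ℝ}, x < z → ∀ᶠ n in atTop, x + s n ≤ z := fun {x z} hxz =>
    ((hslim.const_add x).eventually_lt_const (by simpa using hxz)).mono fun n hn => hn.le
  set G : ℕ → ℝ → ℝ := fun n x => ∫ y, (L x y - L (x + s n) y) ∂P₁ with hG
  have hdm : ∀ n, Measurable (Function.uncurry fun x y => L x y - L (x + s n) y) := fun n =>
    H.loss.measurable.sub (H.loss.measurable_shift (s n))
  have hGm : ∀ n, Measurable (G n) := fun n =>
    ((hdm n).stronglyMeasurable.integral_prod_right (ν := P₁)).measurable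
  set k : ℕ → ℝ → ℝ → ℝ := fun n x y => if x ∈ Ioo a b then
    max (-1) (min 1 ((L x y - L (x + s n) y) / (C * G n x * ω y))) else 0 with hk
  have hkm : ∀ n, Measurable (Function.uncurry (k n)) := fun n => by
    refine Measurable.ite (measurable_fst measurableSet_Ioo) ?_ measurable_const
    exact measurable_const.max (measurable_const.min ((hdm n).div
      ((((hGm n).const_mul C).comp measurable_fst).mul
        (H.measurable_weight.comp measurable_snd))))
  have hk1 : ∀ n x y, |k n x y| ≤ 1 := by
    intro n x y
    simp only [hk]
    split_ifs
    · rw [abs_le]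
      exact ⟨le_max_left _ _, max_le (by norm_num) (min_le_left _ _)⟩
    · simp
  have hki : ∀ x n, ∀ P ∈ 𝓒, Integrable (fun y => ω y * k n x y) P := fun x n P hP =>
    (H.admissible.integrable_weight P hP).mul_bdd (c := 1)
      (hkm n).of_uncurry_left.aestronglyMeasurable (.of_forall (hk1 n x))
  -- For large `n` the truncation of the normalized differences has no effect.
  have hev : ∀ x ∈ Ioo a b, ∀ᶠ n in atTop, 0 < G n x ∧ x + s n ≤ b ∧ ∀ P ∈ 𝓒,
      ∫ y, ω y * k n x y ∂P = (C * G n x)⁻¹ * ∫ y, (L x y - L (x + s n) y) ∂P := by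
    intro x hx
    filter_upwards [hsx hx.2] with n hn
    have hGpos : 0 < G n x := H.integral_sub_pos hP₁ (hI x hx.1.le hx.2.le)
      (by linarith [hs0 n]) (by linarith)
    refine ⟨hGpos, hn, fun P hP => ?_⟩
    rw [← integral_const_mul]
    refine integral_congr_ae ?_
    filter_upwards [hbd x (x + s n) hx.1.le (by linarith [hs0 n]) hn P hP] with y hy
    have hpos : 0 < C * G n x * ω y := by have := h0 y; positivity
    have h1 : |(L x y - L (x + s n) y) / (C * G n x * ω y)| ≤ 1 := by
      rw [abs_div, abs_of_pos hpos, div_le_one hpos]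
      exact hy.1
    rw [abs_le] at h1
    simp only [hk, if_pos hx]
    rw [min_eq_right h1.2, max_eq_right h1.1]
    have := (h0 y).ne'
    field_simp
  have hmain : ∀ x ∈ Ioo a b, ∀ P ∈ 𝓒, ∃ l,
      Tendsto (fun n => ∫ y, ω y * k n x y ∂P) atTop (𝓝 l) ∧
        (α P < x → l < 0) ∧ (α P = x → l = 0) ∧ (x < α P → 0 < l) := by
    intro x hx P hP
    refine H.exists_tendsto_of_sign (hki x) ?_ ?_ hP₀ hP₁ (ha.trans hx.1) (hx.2.trans hb)
      (B := ∫ y, ω y ∂P₀) (κ := C⁻¹) ?_ (inv_pos.2 hC) ?_ hP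
    · intro P hP hPx
      filter_upwards [hev x hx] with n hn
      rw [hn.2.2 P hP]
      refine mul_nonpos_of_nonneg_of_nonpos (inv_nonneg.2 (mul_pos hC hn.1).le) ?_
      exact (H.integral_sub_neg hP hPx.le (by linarith [hs0 n])
        (hI _ (by linarith [hs0 n, hx.1]) hn.2.1)).le
    · intro P hP hPx
      filter_upwards [hev x hx, hsx hPx] with n hn hn'
      rw [hn.2.2 P hP]
      refine mul_nonneg (inv_nonneg.2 (mul_pos hC hn.1).le) ?_
      exact (H.integral_sub_pos hP (hI x hx.1.le hx.2.le) (by linarith [hs0 n]) hn').le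
    · refine .of_forall fun n => ?_
      rw [← Real.norm_eq_abs]
      refine norm_integral_le_of_norm_le (H.admissible.integrable_weight P₀ hP₀)
        (.of_forall fun y => ?_)
      rw [Real.norm_eq_abs, abs_mul, abs_of_pos (h0 y)]
      exact mul_le_of_le_one_right (h0 y).le (hk1 n x y)
    · filter_upwards [hev x hx] with n hn
      rw [hn.2.2 P₁ hP₁]
      change (C * G n x)⁻¹ * G n x = C⁻¹
      have := hn.1.ne'
      field_simp
  obtain ⟨V, hVm, hVω, hV⟩ := H.admissible.exists_measurable_integral_limit H.measurable_weight
    H.one_le_weight hkm hk1 (by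
      intro x P hP
      by_cases hx : x ∈ Ioo a b
      · obtain ⟨l, hl, -⟩ := hmain x hx P hP
        exact ⟨l, hl⟩
      · refine ⟨0, ?_⟩
        simp only [hk, if_neg hx, mul_zero, integral_zero]
        exact tendsto_const_nhds)
  refine ⟨V, hVm, hVω, fun x hx P hP => ?_⟩
  obtain ⟨l, hl, hl'⟩ := hmain x hx P hP
  rw [← tendsto_nhds_unique hl (hV x P hP)]
  exact hl'

/-- There is a jointly measurable function, bounded by the weight, whose expectation at every
interior level `x` has the sign of `α - x`. -/
theorem exists_sign_function (H : IsRegularlyElicited ω 𝓒 α L) :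
    ∃ V : ℝ → ℝ → ℝ, Measurable (Function.uncurry V) ∧ ∀ x ∈ interior (α '' 𝓒),
      (∀ y, |V x y| ≤ ω y) ∧ ∀ P ∈ 𝓒, (α P < x → ∫ y, V x y ∂P < 0) ∧
        (α P = x → ∫ y, V x y ∂P = 0) ∧ (x < α P → 0 < ∫ y, V x y ∂P) := by
  refine exists_measurable_uncurry_of_locally (p := fun x v => (∀ y, |v y| ≤ ω y) ∧ ∀ P ∈ 𝓒,
    (α P < x → ∫ y, v y ∂P < 0) ∧ (α P = x → ∫ y, v y ∂P = 0) ∧ (x < α P → 0 < ∫ y, v y ∂P))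
    fun x hx => ?_
  obtain ⟨P₀, hP₀, P₁, hP₁, a, b, h₀, hax, hxb, h₁⟩ := exists_between_of_mem_interior hx
  obtain ⟨V, hVm, hVω, hV⟩ := H.exists_sign_function_Ioo hP₀ hP₁ h₀ h₁
  exact ⟨Ioo a b, isOpen_Ioo, ⟨hax, hxb⟩, V, hVm, fun z hz => ⟨hVω z, hV z hz⟩⟩

end IsRegularlyElicited

end

/-! ### Identification and the moment condition -/

section

/-- `V` is bounded by the weight, its expectation at every interior level `x` has the sign of
`α - x`, and it satisfies the identification equation at the end points of the image as well. -/
structure IsSignFunction (ω : ℝ → ℝ) (𝓒 : Set (Measure ℝ)) (α : Measure ℝ → ℝ)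
    (V : ℝ → ℝ → ℝ) : Prop where
  measurable : Measurable (Function.uncurry V)
  abs_le : ∀ x y, |V x y| ≤ ω y
  neg : ∀ x ∈ interior (α '' 𝓒), ∀ P ∈ 𝓒, α P < x → ∫ y, V x y ∂P < 0
  pos : ∀ x ∈ interior (α '' 𝓒), ∀ P ∈ 𝓒, x < α P → 0 < ∫ y, V x y ∂P
  zero : ∀ P ∈ 𝓒, ∫ y, V (α P) y ∂P = 0

variable {ω : ℝ → ℝ} {𝓒 : Set (Measure ℝ)} {α : Measure ℝ → ℝ} {L V : ℝ → ℝ → ℝ}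

theorem IsRegularlyElicited.exists_isSignFunction (H : IsRegularlyElicited ω 𝓒 α L) :
    ∃ V : ℝ → ℝ → ℝ, IsSignFunction ω 𝓒 α V ∧ IsIdentificationFunction 𝓒 α V := by
  classical
  obtain ⟨V, hVm, hV⟩ := H.exists_sign_function
  set U := interior (α '' 𝓒) with hU
  -- On the boundary `0` solves the identification equation; off the closure of the image, `1` makes
  -- sure that it has no solution.
  set W : ℝ → ℝ → ℝ := fun x y => if x ∈ frontier (α '' 𝓒) then 0 else if x ∈ U then V x y else 1
    with hW
  have hWU : ∀ x ∈ U, W x = V x := fun x hx => by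
    ext y
    simp only [hW]
    rw [if_neg fun h => h.2 hx, if_pos hx]
  have hWm : Measurable (Function.uncurry W) :=
    Measurable.ite (measurable_fst isClosed_frontier.measurableSet) measurable_const
      (Measurable.ite (measurable_fst isOpen_interior.measurableSet) hVm measurable_const)
  have hWω : ∀ x y, |W x y| ≤ ω y := by
    intro x y
    have h1 := H.one_le_weight y
    by_cases hx : x ∈ U
    · rw [hWU x hx]
      exact (hV x hx).1 y
    · simp only [hW, if_neg hx]
      split_ifs <;> simp <;> linarith
  have hW0 : ∀ P ∈ 𝓒, ∫ y, W (α P) y ∂P = 0 := by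
    intro P hP
    by_cases hx : α P ∈ U
    · rw [hWU _ hx]
      exact ((hV _ hx).2 P hP).2.1 rfl
    · have : α P ∈ frontier (α '' 𝓒) := ⟨subset_closure ⟨P, hP, rfl⟩, hx⟩
      simp [hW, this]
  refine ⟨W, ⟨hWm, hWω, fun x hx P hP h => ?_, fun x hx P hP h => ?_, hW0⟩,
    ⟨hWm, fun P hP x => ?_, hW0, fun P hP x hx h => ?_⟩⟩
  · rw [hWU x hx]
    exact ((hV x hx).2 P hP).1 h
  · rw [hWU x hx]
    exact ((hV x hx).2 P hP).2.2 h
  · exact (H.admissible.integrable_weight P hP).mono' hWm.of_uncurry_left.aestronglyMeasurable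
      (.of_forall (hWω x))
  · by_cases hxU : x ∈ U
    · rw [hWU x hxU] at h
      rcases lt_trichotomy (α P) x with hlt | heq | hgt
      · exact absurd h (((hV x hxU).2 P hP).1 hlt).ne
      · exact heq.symm
      · exact absurd h (((hV x hxU).2 P hP).2.2 hgt).ne'
    · have := H.admissible.isProbabilityMeasure P hP
      simp [hW, hx, hxU] at h

/-- Along a kernel with values in the class, the functional agrees with a measurable function.
This holds without any measurability of the class: the function is the supremum of the rational
interior levels at which the expectation of `V` is positive. -/
theorem IsSignFunction.exists_measurable_eq (hV : IsSignFunction ω 𝓒 α V)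
    (hI : OrdConnected (α '' 𝓒)) {Ω : Type*} [MeasurableSpace Ω] (κ : Kernel Ω ℝ)
    [IsSFiniteKernel κ] : ∃ Z : Ω → ℝ, Measurable Z ∧ ∀ a, κ a ∈ 𝓒 → Z a = α (κ a) := by
  classical
  set I := α '' 𝓒 with hIdef
  -- If `α (κ a)` is the minimum `c` of the image, there are no interior levels below it.
  let c : EReal := sInf ((fun r : ℝ => (r : EReal)) '' I)
  let A : ℚ → Set Ω := fun q => {a | (q : ℝ) ∈ interior I ∧ 0 < ∫ y, V q y ∂(κ a)}
  have hA : ∀ q, MeasurableSet (A q) := by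
    intro q
    have : Measurable fun a => ∫ y, V q y ∂(κ a) :=
      (hV.measurable.of_uncurry_left.stronglyMeasurable.integral_kernel).measurable
    exact (MeasurableSet.const _).inter (this measurableSet_Ioi)
  let E : Ω → EReal := fun a => c ⊔ ⨆ q : ℚ, if a ∈ A q then ((q : ℝ) : EReal) else ⊥
  refine ⟨fun a => (E a).toReal, ?_, fun a ha => ?_⟩
  · refine Measurable.ereal_toReal (measurable_const.sup (.iSup fun q => ?_))
    exact Measurable.ite (hA q) measurable_const measurable_const
  set β := α (κ a) with hβ
  have hβI : β ∈ I := ⟨_, ha, rfl⟩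
  have hmem : ∀ q : ℚ, (q : ℝ) ∈ interior I → (a ∈ A q ↔ (q : ℝ) < β) := by
    intro q hq
    refine ⟨fun h => ?_, fun h => ⟨hq, hV.pos q hq _ ha h⟩⟩
    by_contra! hle
    rcases hle.lt_or_eq with hlt | heq
    · exact absurd h.2 (hV.neg q hq _ ha hlt).not_gt
    · have h1 := hV.zero _ ha
      have h2 := h.2
      rw [← heq] at h2
      exact h2.ne' h1
  suffices E a = (β : EReal) by
    change (E a).toReal = β
    rw [this, EReal.toReal_coe]
  refine le_antisymm (sup_le (sInf_le ⟨β, hβI, rfl⟩) (iSup_le fun q => ?_)) ?_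
  · split_ifs with h
    · exact EReal.coe_le_coe_iff.2 ((hmem q h.1).1 h).le
    · exact bot_le
  · refine le_of_forall_lt fun d hd => ?_
    rcases lt_or_ge d c with hdc | hcd
    · exact hdc.trans_le le_sup_left
    obtain ⟨_, ⟨i, hi, rfl⟩, hiβ⟩ := sInf_lt_iff.1 (hcd.trans_lt hd)
    obtain ⟨q, hq1, hq2⟩ := EReal.lt_iff_exists_rat_btwn.1 (max_lt hd hiβ)
    have hiq : i < q := EReal.coe_lt_coe_iff.1 ((le_max_right _ _).trans_lt hq1)
    have hqβ : (q : ℝ) < β := EReal.coe_lt_coe_iff.1 hq2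
    have hint : (q : ℝ) ∈ interior I := mem_interior.2 ⟨Ioo i β,
      Ioo_subset_Icc_self.trans (hI.out hi hβI), isOpen_Ioo, hiq, hqβ⟩
    have hmq := (hmem q hint).2 hqβ
    refine ((le_max_left _ _).trans_lt hq1).trans_le ?_
    refine le_trans ?_ (le_sup_right.trans' (le_iSup _ q))
    rw [if_pos hmq]

/-- The moment condition, for a general conditioning map `T`; conditioning on a sub-σ-algebra is the
case in which `T` is the identity to the coarser measurable space. -/
theorem IsSignFunction.moment_condition (hV : IsSignFunction ω 𝓒 α V)
    (hI : OrdConnected (α '' 𝓒)) {Ω Ω' E : Type*} [MeasurableSpace Ω] [MeasurableSpace Ω']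
    [NormedAddCommGroup E] [NormedSpace ℝ E] [CompleteSpace E] [SecondCountableTopology E]
    [MeasurableSpace E] [BorelSpace E] {μ : Measure Ω} [IsProbabilityMeasure μ] {T : Ω → Ω'}
    (hT : Measurable T) {X Y : Ω → ℝ} (hY : Measurable Y)
    (hmem : ∀ᵐ a ∂μ, condDistrib Y T μ (T a) ∈ 𝓒)
    (hX : ∀ᵐ a ∂μ, X a = α (condDistrib Y T μ (T a))) {W : Ω' → E} (hW : Measurable W) :
    (Integrable (fun a => ω (Y a) • W (T a)) μ → Integrable (fun a => V (X a) (Y a) • W (T a)) μ) ∧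
    (Integrable (fun a => V (X a) (Y a) • W (T a)) μ → ∫ a, V (X a) (Y a) • W (T a) ∂μ = 0) := by
  obtain ⟨Z, hZ, hZα⟩ := hV.exists_measurable_eq hI (condDistrib Y T μ)
  let φ : Ω' × ℝ → E := fun p => V (Z p.1) p.2 • W p.1
  have hVZ : Measurable fun p : Ω' × ℝ => V (Z p.1) p.2 :=
    hV.measurable.comp ((hZ.comp measurable_fst).prodMk measurable_snd)
  have hφ : Measurable φ := hVZ.smul (hW.comp measurable_fst)
  have hTY : Measurable fun a => (T a, Y a) := hT.prodMk hY
  have hcongr : (fun a => V (X a) (Y a) • W (T a)) =ᵐ[μ] fun a => φ (T a, Y a) := by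
    filter_upwards [hmem, hX] with a h1 h2
    simp only [φ]
    rw [hZα _ h1, h2]
  refine ⟨fun h => ?_, fun h => ?_⟩
  · refine (h.norm.mono' (hφ.comp hTY).aestronglyMeasurable (.of_forall fun a => ?_)).congr
      hcongr.symm
    simp only [φ, Function.comp_apply, norm_smul]
    exact mul_le_mul_of_nonneg_right ((hV.abs_le _ _).trans (le_abs_self _)) (norm_nonneg _)
  · have hint := (integrable_congr hcongr).1 h
    rw [integral_congr_ae hcongr, ← integral_map hTY.aemeasurable hφ.aestronglyMeasurable
      (f := φ)]
    have hint' := (integrable_map_measure hφ.aestronglyMeasurable hTY.aemeasurable).2 hint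
    rw [← compProd_map_condDistrib hY.aemeasurable] at hint' ⊢
    rw [Measure.integral_compProd hint']
    have hm : Measurable fun b => ∫ y, V (Z b) y ∂(condDistrib Y T μ b) :=
      (hVZ.stronglyMeasurable.integral_kernel_prod_right' (κ := condDistrib Y T μ)).measurable
    have hzero : ∀ᵐ b ∂(μ.map T), ∫ y, V (Z b) y ∂(condDistrib Y T μ b) = 0 := by
      refine (ae_map_iff hT.aemeasurable (hm (measurableSet_singleton 0))).2 ?_
      filter_upwards [hmem] with a ha
      rw [hZα _ ha]
      exact hV.zero _ ha
    refine integral_eq_zero_of_ae ?_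
    filter_upwards [hzero] with b hb
    simp only [φ]
    rw [integral_smul_const, hb, zero_smul]
    rfl

end

/-! ### Derivatives of consistent losses -/

section

/-- If the integrals of `D n` over every event converge to those of `g`, then `g` is almost
everywhere the pointwise limit of `D n` at the points where this limit exists.  No uniform
integrability is needed: dominated convergence applies on `{sup |D n| ≤ N}` for each `N`. -/
theorem ae_eq_of_tendsto_setIntegral {P : Measure ℝ} [IsFiniteMeasure P] {D : ℕ → ℝ → ℝ}
    (hD : ∀ n, Measurable (D n)) {g : ℝ → ℝ} (hg : Integrable g P)
    (h : ∀ A, MeasurableSet A →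
      Tendsto (fun n => ∫ y in A, D n y ∂P) atTop (𝓝 (∫ y in A, g y ∂P))) :
    ∀ᵐ y ∂P, ∀ d, Tendsto (fun n => D n y) atTop (𝓝 d) → d = g y := by
  let q : ℝ → ℝ := fun y => limsup (fun n => D n y) atTop
  have hq : Measurable q := Measurable.limsup hD
  let B : ℕ → Set ℝ := fun N =>
    {y | ∃ d, Tendsto (fun n => D n y) atTop (𝓝 d)} ∩ ⋂ n, {y | |D n y| ≤ N}
  have hB : ∀ N, MeasurableSet (B N) := fun N =>
    (measurableSet_exists_tendsto hD).inter
      (.iInter fun n => measurableSet_le (hD n).abs measurable_const)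
  have hqB : ∀ N, ∀ y ∈ B N, Tendsto (fun n => D n y) atTop (𝓝 (q y)) := by
    rintro N y ⟨⟨d, hd⟩, -⟩
    simpa only [q, hd.limsup_eq] using hd
  have hqN : ∀ N, ∀ y ∈ B N, |q y| ≤ N := fun N y hy =>
    le_of_tendsto' (hqB N y hy).abs fun n => mem_iInter.1 hy.2 n
  have key : ∀ N, q =ᵐ[P.restrict (B N)] g := by
    intro N
    have hqi : Integrable q (P.restrict (B N)) :=
      Integrable.of_bound hq.aestronglyMeasurable (N : ℝ)
        ((ae_restrict_iff' (hB N)).2 (.of_forall (hqN N)))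
    refine Integrable.ae_eq_of_forall_setIntegral_eq _ _ hqi hg.integrableOn fun A hA _ => ?_
    rw [Measure.restrict_restrict hA]
    refine tendsto_nhds_unique ?_ (h _ (hA.inter (hB N)))
    refine tendsto_integral_of_dominated_convergence (fun _ => (N : ℝ))
      (fun n => (hD n).aestronglyMeasurable) (integrable_const _) (fun n => ?_) ?_
    · exact (ae_restrict_iff' (hA.inter (hB N))).2
        (.of_forall fun y hy => mem_iInter.1 hy.2.2 n)
    · exact (ae_restrict_iff' (hA.inter (hB N))).2 (.of_forall fun y hy => hqB N y hy.2)
  have key' : ∀ᵐ y ∂P, ∀ N, y ∈ B N → q y = g y :=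
    ae_all_iff.2 fun N => (ae_restrict_iff' (hB N)).1 (key N)
  filter_upwards [key'] with y hy d hd
  obtain ⟨M, hM⟩ := (Metric.isBounded_range_of_tendsto _ hd).exists_norm_le
  obtain ⟨N, hN⟩ := exists_nat_ge M
  have hyB : y ∈ B N := ⟨⟨d, hd⟩, mem_iInter.2 fun n => (hM _ ⟨n, rfl⟩).trans hN⟩
  rw [← hy N hyB]
  exact tendsto_nhds_unique hd (hqB N y hyB)

/-- A property which holds almost everywhere near every point of a set `U` holds almost everywhere
on `U`. -/
theorem ae_of_forall_mem_exists_nhds {U : Set ℝ} {p : ℝ → Prop}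
    (h : ∀ x ∈ U, ∃ a b, x ∈ Ioo a b ∧ ∀ᵐ z, z ∈ Ioo a b → p z) : ∀ᵐ x, x ∈ U → p x := by
  have : volume {x | x ∈ U ∧ ¬ p x} = 0 := by
    refine measure_null_of_locally_null _ fun x hx => ?_
    obtain ⟨a, b, hxab, hab⟩ := h x hx.1
    refine ⟨Ioo a b ∩ {x | x ∈ U ∧ ¬ p x},
      inter_mem (mem_nhdsWithin_of_mem_nhds (isOpen_Ioo.mem_nhds hxab)) self_mem_nhdsWithin,
      measure_mono_null ?_ hab⟩
    intro z hz hz'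
    exact hz.2.2 (hz' hz.1)
  rw [ae_iff]
  simpa only [Classical.not_imp] using this

/-- The difference quotient of `L` in the forecast, with increment `1 / (n + 1)`. -/
noncomputable def diffQuot (L : ℝ → ℝ → ℝ) (n : ℕ) (x y : ℝ) : ℝ :=
  ((n : ℝ) + 1) * (L (x + 1 / ((n : ℝ) + 1)) y - L x y)

theorem HasDerivAt.tendsto_seq {f : ℝ → ℝ} {d x : ℝ} (h : HasDerivAt f d x) :
    Tendsto (fun n : ℕ => ((n : ℝ) + 1) * (f (x + 1 / ((n : ℝ) + 1)) - f x)) atTop (𝓝 d) := by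
  have h1 : Tendsto (fun n : ℕ => 1 / ((n : ℝ) + 1)) atTop (𝓝[>] 0) :=
    tendsto_nhdsWithin_iff.2 ⟨tendsto_one_div_add_atTop_nhds_zero_nat,
      .of_forall fun n => mem_Ioi.2 Nat.one_div_pos_of_nat⟩
  have := h.tendsto_slope_zero_right.comp h1
  simpa [Function.comp_def] using this

variable {ω : ℝ → ℝ} {𝓒 : Set (Measure ℝ)} {α : Measure ℝ → ℝ} {L V : ℝ → ℝ → ℝ}

theorem IsConsistentLoss.measurable_diffQuot (hL : IsConsistentLoss 𝓒 α L) (n : ℕ) :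
    Measurable (Function.uncurry (diffQuot L n)) :=
  ((hL.measurable_shift _).sub hL.measurable).const_mul _

theorem IsConsistentLoss.integrable_diffQuot (hL : IsConsistentLoss 𝓒 α L) (n : ℕ) (x : ℝ)
    {P : Measure ℝ} (hP : P ∈ 𝓒) : Integrable (diffQuot L n x) P :=
  (hL.integrable_sub hP _ _).const_mul _

theorem IsConsistentLoss.integral_diffQuot (hL : IsConsistentLoss 𝓒 α L) (n : ℕ) (x : ℝ)
    {P : Measure ℝ} (hP : P ∈ 𝓒) : ∫ y, diffQuot L n x y ∂P
      = ((n : ℝ) + 1) * (∫ y, L (x + 1 / ((n : ℝ) + 1)) y ∂P - ∫ y, L x y ∂P) := by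
  simp only [diffQuot]
  rw [integral_const_mul, integral_sub (hL.integrable P hP _) (hL.integrable P hP _)]

namespace IsRegularlyElicited

theorem monotoneOn_expectedLoss (H : IsRegularlyElicited ω 𝓒 α L) {P : Measure ℝ} (hP : P ∈ 𝓒)
    {s : Set ℝ} (hs : s ⊆ α '' 𝓒) (hPs : ∀ x ∈ s, α P ≤ x) :
    MonotoneOn (fun x => ∫ y, L x y ∂P) s := by
  intro u hu v hv huv
  rcases huv.eq_or_lt with rfl | hlt
  · exact le_rfl
  have := H.integral_sub_neg hP (hPs u hu) hlt (hs hv)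
  rw [integral_sub (H.loss.integrable P hP _) (H.loss.integrable P hP _)] at this
  simp only
  linarith

theorem antitoneOn_expectedLoss (H : IsRegularlyElicited ω 𝓒 α L) {P : Measure ℝ} (hP : P ∈ 𝓒)
    {s : Set ℝ} (hs : s ⊆ α '' 𝓒) (hPs : ∀ x ∈ s, x ≤ α P) :
    AntitoneOn (fun x => ∫ y, L x y ∂P) s := by
  intro u hu v hv huv
  rcases huv.eq_or_lt with rfl | hlt
  · exact le_rfl
  have := H.integral_sub_pos hP (hs hu) hlt (hPs v hv)
  rw [integral_sub (H.loss.integrable P hP _) (H.loss.integrable P hP _)] at this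
  simp only
  linarith

/-- The number `w` is the asymptotic proportionality factor at the level `x` between expected
difference quotients of `L` and expectations of `V`. -/
def _root_.IsScaling (𝓒 : Set (Measure ℝ)) (L V : ℝ → ℝ → ℝ) (x w : ℝ) : Prop :=
  ∀ P ∈ 𝓒, Tendsto (fun n => ∫ y, diffQuot L n x y ∂P) atTop (𝓝 (w * ∫ y, V x y ∂P))

/-- The expected losses of two reference distributions are monotone, hence differentiable, at almost
every level between their values; by proportionality this gives the convergence of the expected
difference quotients under all members of the class. -/
theorem ae_exists_isScaling (H : IsRegularlyElicited ω 𝓒 α L) (hV : IsSignFunction ω 𝓒 α V) :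
    ∀ᵐ x, x ∈ interior (α '' 𝓒) → ∃ w, IsScaling 𝓒 L V x w := by
  refine ae_of_forall_mem_exists_nhds fun x₀ hx₀ => ?_
  obtain ⟨P₀, hP₀, P₁, hP₁, a, b, h₀, hax, hxb, h₁⟩ := exists_between_of_mem_interior hx₀
  refine ⟨a, b, ⟨hax, hxb⟩, ?_⟩
  have hI : Ioo a b ⊆ α '' 𝓒 := fun x hx =>
    H.ordConnected_image.out ⟨P₀, hP₀, rfl⟩ ⟨P₁, hP₁, rfl⟩
      ⟨h₀.le.trans hx.1.le, hx.2.le.trans h₁.le⟩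
  have d₀ := (H.monotoneOn_expectedLoss hP₀ hI fun x hx => (h₀.trans hx.1).le)
    |>.ae_differentiableWithinAt measurableSet_Ioo
  have d₁ := (H.antitoneOn_expectedLoss hP₁ hI fun x hx => (hx.2.trans h₁).le).neg
    |>.ae_differentiableWithinAt measurableSet_Ioo
  filter_upwards [(ae_restrict_iff' measurableSet_Ioo).1 d₀,
    (ae_restrict_iff' measurableSet_Ioo).1 d₁] with x e₀ e₁ hx
  have hxU : x ∈ interior (α '' 𝓒) := mem_interior.2 ⟨Ioo a b, hI, isOpen_Ioo, hx⟩
  have hnhds : Ioo a b ∈ 𝓝 x := isOpen_Ioo.mem_nhds hx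
  have t₀ := ((e₀ hx).differentiableAt hnhds).hasDerivAt.tendsto_seq.neg
  have t₁ := ((e₁ hx).differentiableAt hnhds).hasDerivAt.tendsto_seq
  have eneg : ∀ n, ∀ P ∈ 𝓒, ∫ y, -diffQuot L n x y ∂P = -(((n : ℝ) + 1) *
      (∫ y, L (x + 1 / ((n : ℝ) + 1)) y ∂P - ∫ y, L x y ∂P)) := fun n P hP => by
    rw [integral_neg, H.loss.integral_diffQuot n x hP]
  have hpos : ∀ n : ℕ, (0 : ℝ) < 1 / ((n : ℝ) + 1) := fun n => Nat.one_div_pos_of_nat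
  have hsx : ∀ {z : ℝ}, x < z → ∀ᶠ n : ℕ in atTop, x + 1 / ((n : ℝ) + 1) ≤ z := fun {z} hxz =>
    ((tendsto_one_div_add_atTop_nhds_zero_nat.const_add x).eventually_lt_const
      (by simpa using hxz)).mono fun n hn => hn.le
  have e : ∀ n : ℕ, ∀ P ∈ 𝓒, ∫ y, -diffQuot L n x y ∂P
      = ((n : ℝ) + 1) * ∫ y, (L x y - L (x + 1 / ((n : ℝ) + 1)) y) ∂P := fun n P hP => by
    rw [eneg n P hP, integral_sub (H.loss.integrable P hP _) (H.loss.integrable P hP _)]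
    ring
  have hlim := fun P hP => H.tendsto_mul_of_sign (x := x) (f := fun n y => -diffQuot L n x y)
    (g := V x) (P := P) (P₀ := P₀) (P₁ := P₁)
    (fun n P hP => (H.loss.integrable_diffQuot n x hP).neg) (fun P hP hPx => by
      filter_upwards [hsx hx.2] with n hn
      rw [e n P hP]
      refine mul_nonpos_of_nonneg_of_nonpos (by positivity) (H.integral_sub_neg hP hPx.le
        (by linarith [hpos n]) ?_).le
      exact H.ordConnected_image.out (hI hx) ⟨P₁, hP₁, rfl⟩ ⟨by linarith [hpos n], hn.trans h₁.le⟩)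
    (fun P hP hPx => by
      filter_upwards [hsx hPx] with n hn
      rw [e n P hP]
      exact mul_nonneg (by positivity)
        (H.integral_sub_pos hP (hI hx) (by linarith [hpos n]) hn).le)
    hP₀ hP₁ (h₀.trans hx.1) (hx.2.trans h₁)
    (fun P hP => (H.admissible.integrable_weight P hP).mono'
      hV.measurable.of_uncurry_left.aestronglyMeasurable (.of_forall (hV.abs_le x)))
    (fun P hP hPx => by rw [← hPx]; exact hV.zero P hP)
    (hV.pos x hxU P₁ hP₁ (hx.2.trans h₁)).ne'
    (B := |-deriv (fun x => ∫ y, L x y ∂P₀) x| + 1) (d := deriv (-fun x => ∫ y, L x y ∂P₁) x)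
    (by
      have := (t₀.abs.eventually_lt_const (lt_add_one _)).mono fun n hn => hn.le
      filter_upwards [this] with n hn
      rwa [eneg n P₀ hP₀])
    (by
      refine t₁.congr fun n => ?_
      rw [eneg n P₁ hP₁]
      ring) hP
  refine ⟨-(deriv (-fun x => ∫ y, L x y ∂P₁) x / ∫ y, V x y ∂P₁), fun P hP => ?_⟩
  have := (hlim P hP).neg
  simp only [integral_neg, neg_neg] at this
  rwa [neg_mul]

/-- The scaling factor can be chosen as a measurable function of the level. -/
theorem exists_measurable_scaling (H : IsRegularlyElicited ω 𝓒 α L)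
    (hV : IsSignFunction ω 𝓒 α V) : ∃ w : ℝ → ℝ, Measurable w ∧
      ∀ᵐ x, x ∈ interior (α '' 𝓒) → IsScaling 𝓒 L V x (w x) := by
  obtain ⟨w, hw, hwU⟩ := exists_measurable_uncurry_of_locally (U := interior (α '' 𝓒))
    -- The upper limit is used instead of the derivative of the expected loss because it yields the
    -- scaling factor at every level at which there is one.
    (p := fun x v => (∃ w, IsScaling 𝓒 L V x w) → IsScaling 𝓒 L V x (v 0)) (by
      intro x₀ hx₀
      obtain ⟨P₀, hP₀, P₁, hP₁, a, b, h₀, hax, hxb, h₁⟩ := exists_between_of_mem_interior hx₀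
      have := H.admissible.isProbabilityMeasure P₁ hP₁
      refine ⟨Ioo a b, isOpen_Ioo, ⟨hax, hxb⟩, fun x _ =>
        limsup (fun n => ∫ y, diffQuot L n x y ∂P₁) atTop / ∫ y, V x y ∂P₁, ?_, ?_⟩
      · refine Measurable.comp (g := fun x =>
          limsup (fun n => ∫ y, diffQuot L n x y ∂P₁) atTop / ∫ y, V x y ∂P₁) ?_ measurable_fst
        refine (Measurable.limsup fun n => ?_).div ?_
        · exact ((H.loss.measurable_diffQuot n).stronglyMeasurable.integral_prod_right
            (ν := P₁)).measurable
        · exact (hV.measurable.stronglyMeasurable.integral_prod_right (ν := P₁)).measurable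
      · rintro x hx ⟨w, hw⟩
        have hI : Ioo a b ⊆ α '' 𝓒 := fun x hx =>
          H.ordConnected_image.out ⟨P₀, hP₀, rfl⟩ ⟨P₁, hP₁, rfl⟩
            ⟨h₀.le.trans hx.1.le, hx.2.le.trans h₁.le⟩
        have hxU : x ∈ interior (α '' 𝓒) := mem_interior.2 ⟨Ioo a b, hI, isOpen_Ioo, hx⟩
        have hne := (hV.pos x hxU P₁ hP₁ (hx.2.trans h₁)).ne'
        simp only [(hw P₁ hP₁).limsup_eq]
        rwa [mul_div_cancel_right₀ _ hne])
  refine ⟨fun x => w x 0, hw.of_uncurry_right, ?_⟩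
  filter_upwards [H.ae_exists_isScaling hV] with x hx hxU using hwU x hxU (hx hxU)

/-- Where the difference quotients converge, their limit is the scaled identification function. -/
theorem ae_eq_of_isScaling (H : IsRegularlyElicited ω 𝓒 α L) (hV : IsSignFunction ω 𝓒 α V)
    {x w : ℝ} (hw : IsScaling 𝓒 L V x w) {P : Measure ℝ} (hP : P ∈ 𝓒) :
    ∀ᵐ y ∂P, ∀ d, Tendsto (fun n => diffQuot L n x y) atTop (𝓝 d) → d = w * V x y := by
  have := H.admissible.isProbabilityMeasure P hP
  have hVi : Integrable (fun y => w * V x y) P :=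
    ((H.admissible.integrable_weight P hP).mono'
      hV.measurable.of_uncurry_left.aestronglyMeasurable (.of_forall (hV.abs_le x))).const_mul w
  refine ae_eq_of_tendsto_setIntegral (fun n => (H.loss.measurable_diffQuot n).of_uncurry_left)
    hVi fun A _ => ?_
  obtain ⟨Q, hQ, c, hc⟩ := H.admissible.exists_setIntegral_eq hP A
  simp only [hc _ hVi, hc _ (H.loss.integrable_diffQuot _ x hP), integral_const_mul]
  exact ((hw Q hQ).const_mul c).sub (hw P hP)

theorem ae_mem_interior (H : IsRegularlyElicited ω 𝓒 α L) :
    ∀ᵐ x ∂(volume.restrict (α '' 𝓒)), x ∈ interior (α '' 𝓒) := by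
  have hms : MeasurableSet (α '' 𝓒) := H.ordConnected_image.measurableSet
  have : volume (frontier (α '' 𝓒)) = 0 := H.ordConnected_image.convex.addHaar_frontier _
  rw [ae_restrict_iff' hms]
  filter_upwards [measure_eq_zero_iff_ae_notMem.1 this] with x hx hxI
  by_contra hxU
  exact hx ⟨subset_closure hxI, hxU⟩

/-- The derivative in the forecast of a consistent loss function is the identification function,
up to a factor which depends on the forecast only. -/
theorem exists_deriv_eq (H : IsRegularlyElicited ω 𝓒 α L) (hV : IsSignFunction ω 𝓒 α V) :
    ∃ w : ℝ → ℝ, Measurable w ∧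
      (∀ P ∈ 𝓒, ∀ᵐ y ∂P, ∀ᵐ x ∂(volume.restrict (α '' 𝓒)),
        ∀ d : ℝ, HasDerivAt (fun s => L s y) d x → d = w x * V x y) ∧
      ((∀ y, LocallyLipschitzOn (interior (α '' 𝓒)) (fun x => L x y)) →
        ∀ P ∈ 𝓒, ∀ᵐ y ∂P, ∀ᵐ x ∂(volume.restrict (α '' 𝓒)),
          HasDerivAt (fun s => L s y) (w x * V x y) x) := by
  obtain ⟨w, hwm, hw⟩ := H.exists_measurable_scaling hV
  have main : ∀ P ∈ 𝓒, ∀ᵐ y ∂P, ∀ᵐ x ∂(volume.restrict (α '' 𝓒)),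
      ∀ d : ℝ, HasDerivAt (fun s => L s y) d x → d = w x * V x y := by
    intro P hP
    have := H.admissible.isProbabilityMeasure P hP
    let p : ℝ → ℝ → Prop := fun x y =>
      ∀ d, Tendsto (fun n => diffQuot L n x y) atTop (𝓝 d) → d = w x * V x y
    have hp : MeasurableSet {z : ℝ × ℝ | p z.1 z.2} := by
      have hm : ∀ n, Measurable fun z : ℝ × ℝ => diffQuot L n z.1 z.2 :=
        H.loss.measurable_diffQuot
      have hwV : Measurable fun z : ℝ × ℝ => w z.1 * V z.1 z.2 :=
        (hwm.comp measurable_fst).mul hV.measurable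
      have e : {z : ℝ × ℝ | p z.1 z.2}
          = {z | ∃ d, Tendsto (fun n => diffQuot L n z.1 z.2) atTop (𝓝 d)}ᶜ ∪
            {z | Tendsto (fun n => diffQuot L n z.1 z.2) atTop (𝓝 (w z.1 * V z.1 z.2))} := by
        ext z
        constructor
        · intro h
          by_cases hz : ∃ d, Tendsto (fun n => diffQuot L n z.1 z.2) atTop (𝓝 d)
          · obtain ⟨d, hd⟩ := hz
            rw [h d hd] at hd
            exact Or.inr hd
          · exact Or.inl hz
        · rintro (h | h) d hd
          · exact absurd ⟨d, hd⟩ h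
          · exact tendsto_nhds_unique hd h
      rw [e]
      exact (measurableSet_exists_tendsto hm).compl.union (measurableSet_tendsto_fun hm hwV)
    have h1 : ∀ᵐ x ∂(volume.restrict (α '' 𝓒)), ∀ᵐ y ∂P, p x y := by
      filter_upwards [H.ae_mem_interior, ae_restrict_of_ae hw] with x hx hwx
      exact H.ae_eq_of_isScaling hV (hwx hx) hP
    filter_upwards [(Measure.ae_ae_comm hp).1 h1] with y hy
    filter_upwards [hy] with x hx d hd
    exact hx d hd.tendsto_seq
  refine ⟨w, hwm, main, fun hLip P hP => ?_⟩
  have hdiff : ∀ y, ∀ᵐ x, x ∈ interior (α '' 𝓒) → DifferentiableAt ℝ (fun s => L s y) x := by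
    intro y
    refine ae_of_forall_mem_exists_nhds fun x hx => ?_
    obtain ⟨K, t, ht, hKt⟩ := hLip y hx
    rw [nhdsWithin_eq_nhds.2 (isOpen_interior.mem_nhds hx)] at ht
    obtain ⟨ε, hε, hball⟩ := Metric.mem_nhds_iff.1 ht
    rw [Real.ball_eq_Ioo] at hball
    refine ⟨x - ε, x + ε, ⟨by linarith, by linarith⟩, ?_⟩
    have := (ae_restrict_iff' measurableSet_Ioo).1
      ((hKt.mono hball).ae_differentiableWithinAt_real measurableSet_Ioo)
    filter_upwards [this] with z hz hzO
    exact (hz hzO).differentiableAt (isOpen_Ioo.mem_nhds hzO)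
  filter_upwards [main P hP] with y hy
  filter_upwards [hy, H.ae_mem_interior, ae_restrict_of_ae (hdiff y)] with x hx hxU hd
  have := (hd hxU).hasDerivAt
  rwa [hx _ this] at this

end IsRegularlyElicited

end

theorem lemma1
    (ω : ℝ → ℝ) (hω : Measurable ω) (hω_one : ∀ y, 1 ≤ ω y)
    (𝓒 : Set (Measure ℝ)) (h𝓒 : AdmissibleClass ω 𝓒)
    (α : Measure ℝ → ℝ)
    (h_elic : Elicitable 𝓒 α)
    (h_cont : ContinuousFunctional ω 𝓒 α)
    (h_nonconst : LocallyNonconstant ω 𝓒 α) :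
    ∃ V : ℝ → ℝ → ℝ,
      IsIdentificationFunction 𝓒 α V ∧
      (∀ x y, |V x y| ≤ ω y) ∧
      -- the moment condition
      (∀ (Ω : Type*) (F mΩ : MeasurableSpace Ω) (_ : F ≤ mΩ)
        (μ : Measure Ω) (_ : IsProbabilityMeasure μ) (X Y : Ω → ℝ) (_ : Measurable[mΩ] Y)
        (_ : ∀ᵐ a ∂μ, condLaw F μ Y a ∈ 𝓒)
        (_ : ∀ᵐ a ∂μ, X a = α (condLaw F μ Y a))
        (q : ℕ) (W : Ω → EuclideanSpace ℝ (Fin q)) (_ : Measurable[F] W),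
        (Integrable (fun a => ω (Y a) • W a) μ → Integrable (fun a => V (X a) (Y a) • W a) μ) ∧
        (Integrable (fun a => V (X a) (Y a) • W a) μ → ∫ a, V (X a) (Y a) • W a ∂μ = 0)) ∧
      -- the derivative in `x` of any consistent loss is `V`, up to a factor depending on `x` only
      (∀ L : ℝ → ℝ → ℝ, IsConsistentLoss 𝓒 α L →
        ∃ w : ℝ → ℝ, Measurable w ∧
          (∀ P ∈ 𝓒, ∀ᵐ y ∂P, ∀ᵐ x ∂(volume.restrict (α '' 𝓒)),
            ∀ d : ℝ, HasDerivAt (fun s => L s y) d x → d = w x * V x y) ∧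
          ((∀ y, LocallyLipschitzOn (interior (α '' 𝓒)) (fun x => L x y)) →
            ∀ P ∈ 𝓒, ∀ᵐ y ∂P, ∀ᵐ x ∂(volume.restrict (α '' 𝓒)),
              HasDerivAt (fun s => L s y) (w x * V x y) x)) := by
  obtain ⟨L₀, hL₀⟩ := h_elic
  have regular : ∀ L, IsConsistentLoss 𝓒 α L → IsRegularlyElicited ω 𝓒 α L := fun L hL =>
    ⟨hω, hω_one, h𝓒, h_cont, h_nonconst, hL⟩
  have H := regular L₀ hL₀
  obtain ⟨V, hV, hid⟩ := H.exists_isSignFunction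
  refine ⟨V, hid, hV.abs_le, ?_, fun L hL => (regular L hL).exists_deriv_eq hV⟩
  intro Ω F mΩ hF μ hμ X Y hY hmem hX q W hW
  exact @IsSignFunction.moment_condition _ _ _ _ hV H.ordConnected_image Ω Ω _ mΩ F _ _ _ _ _ _ μ hμ
    (fun b => b) (measurable_id'' hF) X Y hY hmem hX W hW
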